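/- Let $\mathbf S^2_1\subset\mathbf R^3$ be the unit sphere with its Lebesgue (surface) measure $\lambda$, let $\mu_l=l(l+1)$, and let $Q_l(z)=\frac1{2^l l!}\frac{d^l}{dz^l}(z^2-1)^l$ be the Legendre polynomials. For $x=(\sin\vartheta\cos\varphi,\sin\vartheta\sin\varphi,\cos\vartheta)$ let $$Y_{lm}(x)=\sqrt{\tfrac{2l+1}{4\pi}\tfrac{(l-m)!}{(l+m)!}}\,(-1)^m(1-\cos^2\vartheta)^{m/2}\,Q_l^{(m)}(\cos\vartheta)\,e^{im\varphi}\quad(0\le m\le l),\qquad Y_{l,-m}=(-1)^m Y_{lm}^*,$$ be the spherical harmonics. All random objects live on one probability space $(\Omega,\mathfrak F,P)$. *The field.* Let $T=\{T(x):x\in\mathbf S^2_1\}$ be a jointly measurable, real, zero-mean Gaussian random field that is isotropic, i.e. $(T(gx))_x$ and $(T(x))_x$ have the same law for every $g\in SO(3)$, and that has the spectral representation $T(x)=\sum_{l\ge0}\sum_{|m|\le l}a_{lm}Y_{lm}(x)$, with $a_{lm}=\int_{\mathbf S^2_1}T(x)Y_{lm}^*(x)\,\lambda(dx)$, the series (partial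 sums over $l\le L$) converging in $L^2(P)$ for every $x$. Let $\mathfrak F_T$ be the $\sigma$-field generated by $T$. *The subordinate stochastic sphere.* Let $\Psi(\mu)=b\mu+\int_0^\infty(1-e^{-\mu y})M(dy)$, where $b\ge0$ and $M$ is a measure on $(0,\infty)$ with $\int_0^\infty(y\wedge1)M(dy)<\infty$. For every $x\in\mathbf S^2_1$ let $B^x$ be a Brownian motion on $\mathbf S^2_1$ started at $x$, that is, the continuous Markov process with transition density $p_t(y,z)=\sum_{l\ge0}\frac{2l+1}{4\pi}Q_l(\langle y,z\rangle)e^{-t\mu_l}$ with respect to $\lambda$, and let $D^x$ be a subordinator independent of $B^x$ with $E[e^{-\mu D^x_t}]=e^{-t\Psi(\mu)}$. Let $\mathfrak G\subset\mathfrak F$ be a $\sigma$-field such that $(y,\omega)\mapsto T(y)(\omega)$ is $\mathscr B(\mathbf S^2_1)\otimes\mathfrak G$-measurable and such that, for every $x$, the pair $(B^x,D^x)$ is independent of $\mathfrak G$ (so that $T$ is independent of $(B^x,D^x)$). Put $$\mathfrak T^\Psi_t(x)=T\big(B^x_{D^x_t}\big),\qquad \eta^\Psi_t(x)=E\big[\mathfrak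 T^\Psi_t(x)\,\big|\,\mathfrak F_T\big],\qquad t\ge0 .$$ *Claim.* For all $t\ge0$, $n\in\mathbf N$ (including $n=0$), $x\in\mathbf S^2_1$ and $g\in SO(3)$, the variables $\mathfrak T^\Psi_t(x)$, $\eta^\Psi_t(x)^n$ and $a_{l_10}\cdots a_{l_n0}$ are integrable, and $$E\big[\eta^\Psi_t(gx)^n\big]=E\big[\eta^\Psi_t(x)^n\big]=\sum_{l_1,\dots,l_n\ge0}\ \Big(\prod_{j=1}^n e^{-t\Psi(\mu_{l_j})}\Big)\sqrt{\frac{\prod_{j=1}^n(2l_j+1)}{(4\pi)^n}}\;E\big[a_{l_10}\cdots a_{l_n0}\big],$$ where the multiple series converges unconditionally. -/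

import Mathlib

open MeasureTheory ProbabilityTheory Filter Topology
open scoped NNReal ENNReal

noncomputable section

namespace SphereField

/-! ### The sphere, rotations, spherical harmonics -/

/-- Euclidean three-space. -/
abbrev E3 : Type := EuclideanSpace ℝ (Fin 3)

/-- The unit sphere of `ℝ³`. -/
abbrev S2 : Type := Metric.sphere (0 : E3) 1

/-- The Lebesgue (surface) measure on the unit sphere, of total mass `4π`. -/
def surface : Measure S2 := (volume : Measure E3).toSphere

/-- The rotation group `SO(3)`. -/
abbrev SO3 : Type := Matrix.specialOrthogonalGroup (Fin 3) ℝ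

theorem rotate_mem (g : SO3) (x : S2) :
    Matrix.toEuclideanLin (g : Matrix (Fin 3) (Fin 3) ℝ) (x : E3) ∈ Metric.sphere (0 : E3) 1 := by
  have hg : (g : Matrix (Fin 3) (Fin 3) ℝ).transpose * (g : Matrix (Fin 3) (Fin 3) ℝ) = 1 := by
    have h := (Matrix.mem_specialUnitaryGroup_iff.mp g.2).1
    exact Matrix.mem_unitaryGroup_iff'.mp h
  have hx : ‖(x : E3)‖ = 1 := by simp
  have key : ‖Matrix.toEuclideanLin (g : Matrix (Fin 3) (Fin 3) ℝ) (x : E3)‖ ^ 2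
      = ‖(x : E3)‖ ^ 2 := by
    rw [← real_inner_self_eq_norm_sq, ← real_inner_self_eq_norm_sq]
    simp only [EuclideanSpace.inner_eq_star_dotProduct, star_trivial, Matrix.toLpLin_apply]
    rw [Matrix.dotProduct_mulVec, Matrix.vecMul_mulVec, hg, Matrix.vecMul_one]
  rw [mem_sphere_zero_iff_norm]
  rw [hx] at key
  nlinarith [norm_nonneg (Matrix.toEuclideanLin (g : Matrix (Fin 3) (Fin 3) ℝ) (x : E3))]

/-- The action `x ↦ g x` of `SO(3)` on the sphere. -/
def rotate (g : SO3) (x : S2) : S2 :=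
  ⟨Matrix.toEuclideanLin (g : Matrix (Fin 3) (Fin 3) ℝ) (x : E3), rotate_mem g x⟩

/-- Legendre polynomials, by Rodrigues' formula
`Q_l(z) = (2^l l!)⁻¹ (d/dz)^l (z² - 1)^l`. -/
def legendre (l : ℕ) : Polynomial ℝ :=
  Polynomial.C (((2 : ℝ) ^ l * (l.factorial : ℝ))⁻¹) *
    Polynomial.derivative^[l] ((Polynomial.X ^ 2 - 1) ^ l)

/-- Associated Legendre functions
`Q_{lm}(z) = (-1)^m (1 - z²)^{m/2} (d/dz)^m Q_l(z)`, for `m ≥ 0`. -/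
def assocLegendre (l m : ℕ) (z : ℝ) : ℝ :=
  (-1) ^ m * Real.sqrt (1 - z ^ 2) ^ m * (Polynomial.derivative^[m] (legendre l)).eval z

/-- Spherical harmonics `Y_{lm}` with `m ≥ 0`. With
`x = (sin ϑ cos φ, sin ϑ sin φ, cos ϑ)` one has `cos ϑ = x₂` and `φ = arg (x₀ + i x₁)`
(coordinates are numbered from `0`). -/
def sphericalHarmonicNonneg (l m : ℕ) (x : S2) : ℂ :=
  (Real.sqrt ((2 * (l : ℝ) + 1) / (4 * Real.pi)
      * (((l - m).factorial : ℝ) / ((l + m).factorial : ℝ))) : ℂ)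
    * (assocLegendre l m ((x : E3) 2) : ℂ)
    * Complex.exp (Complex.I * (m : ℂ) * (Complex.arg ⟨(x : E3) 0, (x : E3) 1⟩ : ℂ))

/-- Spherical harmonics `Y_{lm}`, `|m| ≤ l`, where `Y_{l,-m} = (-1)^m Y_{lm}^*`. -/
def sphericalHarmonic (l : ℕ) (m : ℤ) (x : S2) : ℂ :=
  if 0 ≤ m then sphericalHarmonicNonneg l m.natAbs x
  else (-1) ^ m.natAbs * (starRingEnd ℂ) (sphericalHarmonicNonneg l m.natAbs x)

/-- `μ_l = l (l + 1)`, where `-μ_l` are the eigenvalues of the spherical Laplacian. -/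
def eigen (l : ℕ) : ℝ := (l : ℝ) * ((l : ℝ) + 1)

/-! ### Isotropic Gaussian random fields -/

variable {Ω : Type*} [mΩ : MeasurableSpace Ω]

/-- Random Fourier coefficients `a_{lm} = ∫ T(x) Y_{lm}^*(x) λ(dx)`. -/
def harmonicCoeff (T : S2 → Ω → ℝ) (l : ℕ) (m : ℤ) (ω : Ω) : ℂ :=
  ∫ x, (T x ω : ℂ) * (starRingEnd ℂ) (sphericalHarmonic l m x) ∂surface

/-- Partial sums of the spectral representation,
`∑_{l ≤ L} ∑_{|m| ≤ l} a_{lm} Y_{lm}(x)`. -/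
def spectralSum (T : S2 → Ω → ℝ) (L : ℕ) (x : S2) (ω : Ω) : ℂ :=
  ∑ l ∈ Finset.range (L + 1), ∑ m ∈ Finset.Icc (-(l : ℤ)) (l : ℤ),
    harmonicCoeff T l m ω * sphericalHarmonic l m x

/-- The `σ`-field `𝔉_T` generated by the random field `T`. -/
@[reducible] def fieldSigma (T : S2 → Ω → ℝ) : MeasurableSpace Ω :=
  ⨆ x : S2, MeasurableSpace.comap (T x) inferInstance

/-- Zero-mean isotropic Gaussian random fields on the sphere with spectral representation
`T(x) = ∑_{lm} a_{lm} Y_{lm}(x)`, the series converging in `L²(P)` for every `x`. -/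
structure IsIsotropicGaussianField (P : Measure Ω) (T : S2 → Ω → ℝ) : Prop where
  measurable : Measurable (fun p : S2 × Ω => T p.1 p.2)
  gaussian : IsGaussianProcess T P
  mean_zero : ∀ x, ∫ ω, T x ω ∂P = 0
  isotropic : ∀ g : SO3,
    IdentDistrib (fun ω (x : S2) => T (rotate g x) ω) (fun ω (x : S2) => T x ω) P P
  spectral : ∀ x : S2,
    Tendsto (fun L : ℕ => eLpNorm (fun ω => (T x ω : ℂ) - spectralSum T L x ω) 2 P) atTop (𝓝 0)

/-! ### Subordinators and subordinate Brownian motion on the sphere -/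

/-- Lévy measures of subordinators: carried by `(0, ∞)`, with `∫ (y ∧ 1) M(dy) < ∞`. -/
structure IsSubordinatorLevyMeasure (M : Measure ℝ) : Prop where
  support : M (Set.Iic 0) = 0
  finite : ∫⁻ y, ENNReal.ofReal (min y 1) ∂M < ∞

/-- The Laplace exponent `Ψ(μ) = b μ + ∫ (1 - e^{-μ y}) M(dy)`. -/
def laplaceExponent (b : ℝ≥0) (M : Measure ℝ) (μ : ℝ) : ℝ :=
  (b : ℝ) * μ + ∫ y, (1 - Real.exp (-μ * y)) ∂M

/-- Subordinators with Laplace exponent `Ψ`: nondecreasing right-continuous processes started at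
`0` with independent stationary increments and `E exp(-μ D_t) = exp(-t Ψ(μ))`. -/
structure IsSubordinator (P : Measure Ω) (Ψ : ℝ → ℝ) (D : ℝ≥0 → Ω → ℝ≥0) : Prop where
  measurable : ∀ t, Measurable (D t)
  zero : ∀ ω, D 0 ω = 0
  mono : ∀ ω, Monotone (fun t => D t ω)
  rightCts : ∀ ω t, ContinuousWithinAt (fun s => D s ω) (Set.Ici t) t
  indep : HasIndepIncrements (fun t ω => (D t ω : ℝ)) P
  stationary : ∀ s h : ℝ≥0,
    IdentDistrib (fun ω => (D (s + h) ω : ℝ) - (D s ω : ℝ)) (fun ω => (D h ω : ℝ)) P P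
  laplace : ∀ (t : ℝ≥0) (μ : ℝ), 0 < μ →
    ∫ ω, Real.exp (-μ * (D t ω : ℝ)) ∂P = Real.exp (-(t : ℝ) * Ψ μ)

/-- The heat kernel on the sphere,
`p_t(x, y) = ∑_l (2l+1)/(4π) Q_l(⟨x, y⟩) e^{-t μ_l}`. -/
def heatKernel (t : ℝ) (x y : S2) : ℝ :=
  ∑' l : ℕ, (2 * (l : ℝ) + 1) / (4 * Real.pi)
    * (legendre l).eval (inner ℝ (x : E3) (y : E3)) * Real.exp (-t * eigen l)

/-- Brownian motion on the sphere started at `x`: the continuous Markov process with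
transition density `p_t`, with respect to its own filtration. -/
structure IsSphericalBrownian (P : Measure Ω) (x : S2) (B : ℝ≥0 → Ω → S2) : Prop where
  measurable : ∀ t, Measurable (B t)
  zero : ∀ ω, B 0 ω = x
  cts : ∀ ω, Continuous (fun t => B t ω)
  markov : ∀ (s h : ℝ≥0), 0 < h → ∀ f : C(S2, ℝ),
    P[fun ω => f (B (s + h) ω) | ⨆ u : Set.Iic s, MeasurableSpace.comap (B u) inferInstance]
      =ᵐ[P] fun ω => ∫ y, heatKernel h (B s ω) y * f y ∂surface

/-- The `σ`-field generated by a whole process. -/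
@[reducible] def processSigma {E : Type*} [MeasurableSpace E] (X : ℝ≥0 → Ω → E) : MeasurableSpace Ω :=
  ⨆ t : ℝ≥0, MeasurableSpace.comap (X t) inferInstance

/-- The subordinate process `B^Ψ_t = B_{D_t}`. -/
def subordinate (B : ℝ≥0 → Ω → S2) (D : ℝ≥0 → Ω → ℝ≥0) (t : ℝ≥0) (ω : Ω) : S2 :=
  B (D t ω) ω

/-- The field indexed by the subordinate stochastic sphere: `T` evaluated at the
subordinate Brownian motion `B_{D_t}` started at `x`. -/
def subordinateField (T : S2 → Ω → ℝ) (B : S2 → ℝ≥0 → Ω → S2) (D : S2 → ℝ≥0 → Ω → ℝ≥0)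
    (t : ℝ≥0) (x : S2) (ω : Ω) : ℝ :=
  T (subordinate (B x) (D x) t ω) ω

/-- The mean subordinate field `η_t(x)`: the conditional expectation given `𝔉_T` of the field
indexed by the subordinate stochastic sphere. -/
def meanSubordinateField (P : Measure Ω) (T : S2 → Ω → ℝ) (B : S2 → ℝ≥0 → Ω → S2)
    (D : S2 → ℝ≥0 → Ω → ℝ≥0) (t : ℝ≥0) (x : S2) : Ω → ℝ :=
  P[subordinateField T B D t x | fieldSigma T]

end SphereField

end

open SphereField

/-! ### Rotations of the sphere and invariance of the surface measure. -/

namespace SphereField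

/-! Everything takes place in the closed linear span `H` of the field in `L²(P)`. Every element `Z`
of `H` is centred Gaussian, so `E Z^n` is `‖Z‖^n` times the `n`-th moment of a standard normal
variable: moments depend on the norm alone.

Because the moving point is independent of the field, the conditional expectation `η_t(x)` is almost
surely the average of `T` against the law of `B^x_{D^x_t}`, an element of `H`
(`condExp_subordinateField`). Let `T_l(x)` be `(2l+1)/(4π)` times the integral of `Q_l(⟨x,z⟩) T(z)`
over the sphere. At the north pole every `Y_{lm}` with `m ≠ 0` vanishes, so there the spectral
representation reads `T = ∑ T_l` with `T_l` a multiple of `a_{l0}`. By isotropy the error of a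
partial sum has the same norm at every point, so `T(x) = ∑ T_l(x)` everywhere, uniformly in `L²`,
and `T` is continuous into `L²`. Distinct degrees are orthogonal, which comes down to orthogonality
of zonal Legendre functions (`integral_legendre_mul_legendre`).

Averaging over the heat kernel multiplies `T_l` by `e^{-s μ_l}`, and averaging over `s = D_t` turns
this into `e^{-tΨ(μ_l)}`. Hence `η_t(x) = ∑ e^{-tΨ(μ_l)} T_l(x)` in `L²`
(`tendsto_sum_smear_subordinate`). The norm of this sum is rotation invariant, so all moments are
the same at `x`, at `gx` and at the pole.

At the pole the `n`-th power of the partial sums expands into the terms of the claimed series.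
Orthogonal elements of `H` are independent and their moments are nonnegative, so every term is
nonnegative (`integral_prod_nonneg`), and convergence along cubes of indices is already
unconditional convergence. -/

instance : IsFiniteMeasure surface := by unfold surface; infer_instance

/-- The rotation by `g` as a linear isometry equivalence of `ℝ³`. -/
noncomputable def rotateEquiv (g : SO3) : E3 ≃ₗᵢ[ℝ] E3 :=
  LinearIsometry.toLinearIsometryEquiv
    ⟨Matrix.toEuclideanLin (g : Matrix (Fin 3) (Fin 3) ℝ), by
      intro v
      have hg : (g : Matrix (Fin 3) (Fin 3) ℝ).transpose * (g : Matrix (Fin 3) (Fin 3) ℝ) = 1 :=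
        Matrix.mem_unitaryGroup_iff'.mp (Matrix.mem_specialUnitaryGroup_iff.mp g.2).1
      have key : ‖Matrix.toEuclideanLin (g : Matrix (Fin 3) (Fin 3) ℝ) v‖ ^ 2 = ‖v‖ ^ 2 := by
        rw [← real_inner_self_eq_norm_sq, ← real_inner_self_eq_norm_sq]
        simp only [EuclideanSpace.inner_eq_star_dotProduct, star_trivial, Matrix.toLpLin_apply]
        rw [Matrix.dotProduct_mulVec, Matrix.vecMul_mulVec, hg, Matrix.vecMul_one]
      exact (sq_eq_sq₀ (norm_nonneg _) (norm_nonneg _)).1 key⟩ rfl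

theorem coe_rotate (g : SO3) (x : S2) : (rotate g x : E3) = rotateEquiv g x := rfl

theorem inner_rotate (g : SO3) (x y : S2) :
    inner ℝ (rotate g x : E3) (rotate g y : E3) = inner ℝ (x : E3) (y : E3) := by
  simp only [coe_rotate, LinearIsometryEquiv.inner_map_map]

theorem continuous_rotate (g : SO3) : Continuous (rotate g) :=
  ((rotateEquiv g).continuous.comp continuous_subtype_val).subtype_mk _

-- The surface measure of a set is a multiple of the volume of the cone over it; forming cones
-- commutes with rotations, and linear isometries preserve volume.
open scoped Pointwise in
theorem measurePreserving_rotate (g : SO3) : MeasurePreserving (rotate g) surface surface := by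
  refine ⟨(continuous_rotate g).measurable, ?_⟩
  ext s hs
  rw [Measure.map_apply (continuous_rotate g).measurable hs, surface,
    Measure.toSphere_apply' _ hs, Measure.toSphere_apply' _
      ((continuous_rotate g).measurable hs)]
  congr 1
  have himg : Set.Ioo (0 : ℝ) 1 • (Subtype.val '' (rotate g ⁻¹' s) : Set E3)
      = rotateEquiv g ⁻¹' (Set.Ioo (0 : ℝ) 1 • (Subtype.val '' s : Set E3)) := by
    ext v
    simp only [Set.mem_smul, Set.mem_image, Set.mem_preimage]
    constructor
    · rintro ⟨r, hr, _, ⟨z, hz, rfl⟩, rfl⟩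
      exact ⟨r, hr, _, ⟨_, hz, rfl⟩, by rw [coe_rotate, map_smul]⟩
    · rintro ⟨r, hr, _, ⟨z, hz, rfl⟩, h⟩
      have hz' : (rotateEquiv g).symm (z : E3) ∈ Metric.sphere (0 : E3) 1 := by
        rw [mem_sphere_zero_iff_norm, LinearIsometryEquiv.norm_map]
        exact mem_sphere_zero_iff_norm.1 z.2
      have hr' : rotate g ⟨_, hz'⟩ = z := Subtype.ext (by rw [coe_rotate]; simp)
      refine ⟨r, hr, _, ⟨⟨_, hz'⟩, by rwa [hr'], rfl⟩, ?_⟩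
      apply (rotateEquiv g).injective
      rw [map_smul, ← h]; simp
  rw [himg]
  exact (rotateEquiv g).measurePreserving.measure_preimage_emb
    (rotateEquiv g).toHomeomorph.measurableEmbedding _

/-- A rotation is a measurable embedding, so no regularity of `f` is needed. -/
theorem integral_rotate (g : SO3) (f : S2 → ℝ) :
    ∫ z, f (rotate g z) ∂surface = ∫ z, f z ∂surface := by
  let e : S2 ≃ S2 := Equiv.ofBijective (rotate g) (by
    constructor
    · intro a b h
      exact Subtype.ext ((rotateEquiv g).injective (by rw [← coe_rotate, h, coe_rotate]))
    · intro z
      have hz' : (rotateEquiv g).symm (z : E3) ∈ Metric.sphere (0 : E3) 1 := by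
        rw [mem_sphere_zero_iff_norm, LinearIsometryEquiv.norm_map]
        exact mem_sphere_zero_iff_norm.1 z.2
      exact ⟨⟨_, hz'⟩, Subtype.ext (by rw [coe_rotate]; simp)⟩)
  have hemb : MeasurableEmbedding (rotate g) :=
    ((continuous_rotate g).isClosedEmbedding e.injective).measurableEmbedding
  exact (measurePreserving_rotate g).integral_comp hemb f

/-- This is the half-turn about the axis `v`, with matrix `2 v vᵀ - 1`; its eigenvalues `1, -1, -1`
give determinant `1`. -/
theorem exists_rotate_axis (v : E3) (hv : ‖v‖ = 1) :
    ∃ g : SO3, ∀ z : S2, (rotate g z : E3) = (2 * inner ℝ v (z : E3)) • v - z := by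
  have hs : v 0 ^ 2 + v 1 ^ 2 + v 2 ^ 2 = 1 := by
    have := EuclideanSpace.real_norm_sq_eq v
    rw [hv, Fin.sum_univ_three] at this
    linarith
  obtain ⟨a, ha⟩ : ∃ a : ℝ, a = v 0 := ⟨_, rfl⟩
  obtain ⟨b, hb⟩ : ∃ b : ℝ, b = v 1 := ⟨_, rfl⟩
  obtain ⟨c, hc⟩ : ∃ c : ℝ, c = v 2 := ⟨_, rfl⟩
  have hs' : a ^ 2 + b ^ 2 + c ^ 2 = 1 := by rw [ha, hb, hc]; exact hs
  clear hs
  let A : Matrix (Fin 3) (Fin 3) ℝ := Matrix.of fun i j => 2 * v i * v j - if i = j then 1 else 0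
  have hA : A ∈ Matrix.specialOrthogonalGroup (Fin 3) ℝ := by
    refine Matrix.mem_specialUnitaryGroup_iff.2 ⟨Matrix.mem_unitaryGroup_iff.2 ?_, ?_⟩
    · ext i j
      fin_cases i <;> fin_cases j <;>
        simp [A, Matrix.mul_apply, Fin.sum_univ_three, Matrix.star_apply, ← ha, ← hb, ← hc] <;> grind
    · rw [Matrix.det_fin_three]
      simp only [A, Matrix.of_apply, ← ha, ← hb, ← hc]
      simp
      grind
  refine ⟨⟨A, hA⟩, fun z => ?_⟩
  ext i
  simp only [rotate, Matrix.toLpLin_apply]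
  fin_cases i <;>
    simp [A, Matrix.mulVec, dotProduct, Fin.sum_univ_three, PiLp.inner_apply] <;> ring

/-- The half-turn about the bisector `x + y` exchanges the two points; for antipodal points any axis
orthogonal to `x` serves. Besides transitivity of the action, the exchange yields symmetry of
rotation-invariant kernels. -/
theorem exists_rotate_swap (x y : S2) : ∃ g : SO3, rotate g x = y ∧ rotate g y = x := by
  have hx : ‖(x : E3)‖ = 1 := by simp
  have hy : ‖(y : E3)‖ = 1 := by simp
  have hxx : inner ℝ (x : E3) (x : E3) = 1 := by rw [real_inner_self_eq_norm_sq, hx]; norm_num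
  have hyy : inner ℝ (y : E3) (y : E3) = 1 := by rw [real_inner_self_eq_norm_sq, hy]; norm_num
  by_cases h : (x : E3) + y = 0
  · obtain ⟨v, hv, hvx⟩ : ∃ v : E3, ‖v‖ = 1 ∧ inner ℝ v (x : E3) = 0 := by
      have : ∃ u : E3, u ≠ 0 ∧ inner ℝ u (x : E3) = 0 := by
        by_cases h0 : (x : E3) 0 = 0
        · exact ⟨EuclideanSpace.single 0 1, by simp, by simp [EuclideanSpace.inner_single_left, h0]⟩
        · refine ⟨!₂[-(x : E3) 1, (x : E3) 0, 0], fun h' => h0 ?_, ?_⟩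
          · simpa using congrArg (fun w : E3 => w 1) h'
          · simp [PiLp.inner_apply, Fin.sum_univ_three]; ring
      obtain ⟨u, hu, hux⟩ := this
      refine ⟨(‖u‖)⁻¹ • u, ?_, by rw [inner_smul_left, hux, mul_zero]⟩
      rw [norm_smul, norm_inv, norm_norm, inv_mul_cancel₀ (norm_ne_zero_iff.2 hu)]
    obtain ⟨g, hg⟩ := exists_rotate_axis v hv
    have hyx : (y : E3) = -x := (neg_eq_of_add_eq_zero_right h).symm
    refine ⟨g, Subtype.ext ?_, Subtype.ext ?_⟩
    · rw [hg, hvx, hyx]; simp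
    · rw [hg, hyx, inner_neg_right, hvx]; simp
  · set s : E3 := (x : E3) + y with hs
    have hn : ‖s‖ ≠ 0 := norm_ne_zero_iff.2 h
    have hss : ‖s‖ ^ 2 = 2 + 2 * inner ℝ (x : E3) (y : E3) := by
      rw [hs, norm_add_sq_real, hx, hy]; ring
    obtain ⟨g, hg⟩ := exists_rotate_axis ((‖s‖)⁻¹ • s) (by
      rw [norm_smul, norm_inv, norm_norm, inv_mul_cancel₀ hn])
    have key : ∀ z : E3, inner ℝ s z = ‖s‖ ^ 2 / 2 →
        (2 * inner ℝ ((‖s‖)⁻¹ • s) z) • ((‖s‖)⁻¹ • s) - z = s - z := by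
      intro z hz
      rw [real_inner_smul_left, hz, smul_smul]
      have : 2 * (‖s‖⁻¹ * (‖s‖ ^ 2 / 2)) * ‖s‖⁻¹ = 1 := by field_simp
      rw [this, one_smul]
    refine ⟨g, Subtype.ext ?_, Subtype.ext ?_⟩
    · rw [hg, key _ (by rw [hss, hs, inner_add_left, hxx, real_inner_comm (x : E3) y]; ring), hs]
      abel
    · rw [hg, key _ (by rw [hss, hs, inner_add_left, hyy]; ring), hs]
      abel

theorem inner_mem_Icc (x y : S2) : inner ℝ (x : E3) (y : E3) ∈ Set.Icc (-1 : ℝ) 1 := by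
  have h := abs_real_inner_le_norm (x : E3) (y : E3)
  simp only [norm_eq_of_mem_sphere, mul_one] at h
  exact abs_le.1 h

/-! ### Legendre polynomials -/

-- Leibniz' rule for `(X - 1)^l (X + 1)^l`; the factorials combine into `l!` times a squared
-- binomial coefficient. Both the value at `1` and a bound on `[-1, 1]` can be read off.
open Polynomial in
theorem legendre_eq_sum (l : ℕ) :
    legendre l = C (((2 : ℝ) ^ l)⁻¹) *
      ∑ k ∈ Finset.range (l + 1), C ((l.choose k : ℝ) ^ 2) * ((X - 1) ^ k * (X + 1) ^ (l - k)) := by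
  have hf : ((l.factorial : ℕ) : ℝ) ≠ 0 := by exact_mod_cast l.factorial_ne_zero
  have h1 : ((X : ℝ[X]) ^ 2 - 1) ^ l = (X - 1) ^ l * (X + 1) ^ l := by
    rw [← mul_pow]; congr 1; ring
  have h2 : ∀ c : ℝ, ∀ k, derivative^[k] ((X + C c : ℝ[X]) ^ l)
      = (l.descFactorial k : ℝ[X]) * (X + C c) ^ (l - k) := by
    intro c k
    rw [iterate_derivative_X_add_pow, nsmul_eq_mul]
  have h3 : (X - 1 : ℝ[X]) = X + C (-1) := by simp [sub_eq_add_neg]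
  have h4 : (X + 1 : ℝ[X]) = X + C 1 := by simp
  rw [legendre, h1, iterate_derivative_mul, Finset.mul_sum, Finset.mul_sum]
  refine Finset.sum_congr rfl fun k hk => ?_
  have hkl : k ≤ l := Nat.lt_succ_iff.1 (Finset.mem_range.1 hk)
  rw [h3, h4, h2, h2, Nat.sub_sub_self hkl, nsmul_eq_mul]
  have hd : ((l.choose k : ℕ) : ℝ) * (l.descFactorial (l - k) * l.descFactorial k)
      = l.factorial * (l.choose k : ℝ) ^ 2 := by
    have e1 := Nat.descFactorial_eq_factorial_mul_choose l (l - k)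
    have e2 := Nat.descFactorial_eq_factorial_mul_choose l k
    rw [Nat.choose_symm hkl] at e1
    have e3 := Nat.choose_mul_factorial_mul_factorial hkl
    rw [e1, e2, ← e3]; push_cast; ring
  have hd' : ((l.choose k : ℕ) : ℝ[X]) * ((l.descFactorial (l - k) : ℕ) * (l.descFactorial k : ℕ) : ℝ[X])
      = C ((l.factorial : ℝ) * (l.choose k : ℝ) ^ 2) := by
    rw [← hd]; simp
  calc _ = C (((2 : ℝ) ^ l * (l.factorial : ℝ))⁻¹) *
        (((l.choose k : ℕ) : ℝ[X]) * ((l.descFactorial (l - k) : ℕ) * (l.descFactorial k : ℕ) : ℝ[X]))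
          * ((X + C (-1)) ^ k * (X + C 1) ^ (l - k)) := by ring
    _ = _ := by
      have hC : (C (((2 : ℝ) ^ l * (l.factorial : ℝ))⁻¹ * (l.factorial * (l.choose k : ℝ) ^ 2)) : ℝ[X])
          = C (((2 : ℝ) ^ l)⁻¹) * C ((l.choose k : ℝ) ^ 2) := by
        rw [← C_mul]; congr 1; field_simp
      rw [hd', ← C_mul, hC]
      ring

theorem legendre_eval_one (l : ℕ) : (legendre l).eval 1 = 1 := by
  rw [legendre_eq_sum]
  simp only [Polynomial.eval_mul, Polynomial.eval_C, Polynomial.eval_finsetSum,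
    Polynomial.eval_pow, Polynomial.eval_sub, Polynomial.eval_add, Polynomial.eval_X,
    Polynomial.eval_one, sub_self]
  rw [Finset.sum_eq_single 0]
  · norm_num
  · intro k _ hk; simp [hk]
  · simp

/-- A crude bound is enough: the heat factor `e^{-s l(l+1)}` beats any geometric growth. -/
theorem abs_legendre_eval_le (l : ℕ) {z : ℝ} (hz : z ∈ Set.Icc (-1 : ℝ) 1) :
    |(legendre l).eval z| ≤ 4 ^ l := by
  rw [legendre_eq_sum]
  simp only [Polynomial.eval_mul, Polynomial.eval_C, Polynomial.eval_finsetSum,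
    Polynomial.eval_pow, Polynomial.eval_sub, Polynomial.eval_add, Polynomial.eval_X,
    Polynomial.eval_one]
  have h1 : |z - 1| ≤ 2 := abs_le.2 ⟨by linarith [hz.1], by linarith [hz.2]⟩
  have h2 : |z + 1| ≤ 2 := abs_le.2 ⟨by linarith [hz.1], by linarith [hz.2]⟩
  rw [abs_mul, abs_of_pos (by positivity)]
  calc (2 ^ l)⁻¹ * |∑ k ∈ Finset.range (l + 1),
        (l.choose k : ℝ) ^ 2 * ((z - 1) ^ k * (z + 1) ^ (l - k))|
      ≤ (2 ^ l)⁻¹ * ∑ k ∈ Finset.range (l + 1), (l.choose k : ℝ) ^ 2 * 2 ^ l := by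
        gcongr
        refine (Finset.abs_sum_le_sum_abs _ _).trans (Finset.sum_le_sum fun k hk => ?_)
        have hkl : k ≤ l := Nat.lt_succ_iff.1 (Finset.mem_range.1 hk)
        rw [abs_mul, abs_mul, abs_pow, abs_pow, abs_pow, abs_of_nonneg (Nat.cast_nonneg _)]
        gcongr
        calc |z - 1| ^ k * |z + 1| ^ (l - k) ≤ 2 ^ k * 2 ^ (l - k) := by gcongr
          _ = 2 ^ l := by rw [← pow_add, Nat.add_sub_cancel' hkl]
    _ = (∑ k ∈ Finset.range (l + 1), (l.choose k : ℝ) ^ 2) := by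
        rw [← Finset.sum_mul]; field_simp
    _ ≤ (∑ k ∈ Finset.range (l + 1), (l.choose k : ℝ)) ^ 2 :=
        Finset.sum_sq_le_sq_sum_of_nonneg fun _ _ => by positivity
    _ = 4 ^ l := by
        have := Nat.sum_range_choose l
        rw [show (∑ k ∈ Finset.range (l + 1), (l.choose k : ℝ)) = 2 ^ l by exact_mod_cast this,
          ← pow_mul, mul_comm, pow_mul]
        norm_num

-- The polynomial `f = (X² - 1)^l` satisfies `(X² - 1) f' = 2 l X f`; differentiating `l + 1` times
-- gives Legendre's equation.
open Polynomial in
theorem legendre_ode (l : ℕ) :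
    (X ^ 2 - 1) * derivative (derivative (legendre l)) + 2 * X * derivative (legendre l)
      = C (eigen l) * legendre l := by
  set f : ℝ[X] := (X ^ 2 - 1) ^ l with hf
  have h0 : (X ^ 2 - 1) * derivative f = 2 * (l : ℝ[X]) * X * f := by
    rcases l with _ | m
    · simp [hf]
    · rw [hf, derivative_pow]
      simp only [derivative_sub, derivative_X_pow, derivative_one, Nat.add_sub_cancel]
      simp only [map_natCast, Nat.cast_ofNat, Nat.cast_add, Nat.cast_one, sub_zero,
        map_add, map_one, map_ofNat]
      norm_num
      ring
  obtain ⟨D, hD⟩ : ∃ D : ℕ → ℝ[X], D = fun j => derivative^[j] f := ⟨_, rfl⟩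
  have hD0 : D 0 = f := by simp [hD]
  have hDs : ∀ j, derivative (D j) = D (j + 1) := fun j => by
    simp only [hD, Function.iterate_succ_apply']
  -- The relation `h0` differentiated `j + 1` times; the case `j = l` is the one wanted.
  have hj : ∀ j : ℕ, (X ^ 2 - 1) * D (j + 2)
      = C (2 * (l : ℝ) - 2 * (j + 1)) * X * D (j + 1)
        + C (2 * (l : ℝ) * (j + 1) - j * (j + 1)) * D j := by
    intro j
    induction j with
    | zero =>
      have := congrArg derivative h0
      rw [← hD0] at this
      simp only [derivative_mul, derivative_sub, derivative_X_pow, derivative_one, derivative_X,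
        derivative_ofNat, derivative_natCast, map_natCast, hDs] at this
      simp only [map_sub, map_mul, map_add, map_natCast, map_one, map_ofNat, Nat.cast_zero] at this ⊢
      norm_num at this ⊢
      linear_combination this
    | succ j ih =>
      have := congrArg derivative ih
      simp only [derivative_mul, derivative_add, derivative_sub, derivative_X_pow, derivative_one,
        derivative_X, derivative_C, hDs] at this
      simp only [show j + 1 + 2 = j + 2 + 1 from rfl, show j + 1 + 1 = j + 2 from rfl] at this ⊢
      simp only [map_sub, map_mul, map_add, map_natCast, map_one, map_ofNat, Nat.cast_add,
        Nat.cast_one] at this ⊢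
      norm_num at this ⊢
      linear_combination this
  have hl := hj l
  simp only [legendre, ← hf, derivative_mul, derivative_C, zero_mul, zero_add]
  rw [show derivative^[l] f = D l by simp [hD], hDs, hDs]
  have he : (C (eigen l) : ℝ[X]) = (l : ℝ[X]) * (l + 1) := by simp [eigen]
  rw [he]
  simp only [map_sub, map_mul, map_add, map_natCast, map_one, map_ofNat] at hl
  linear_combination (C (((2 : ℝ) ^ l * (l.factorial : ℝ))⁻¹)) * hl

theorem eigen_injective : Function.Injective eigen := by
  intro a b h
  simp only [eigen] at h
  have h' : a * (a + 1) = b * (b + 1) := by exact_mod_cast h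
  rcases lt_trichotomy a b with h1 | h1 | h1
  · nlinarith
  · exact h1
  · nlinarith

theorem eigen_nonneg (l : ℕ) : 0 ≤ eigen l := by unfold eigen; positivity

/-! ### Integration by parts on the sphere and orthogonality of zonal Legendre functions. -/

theorem integrable_surface_of_continuous {f : S2 → ℝ} (hf : Continuous f) :
    Integrable f surface := by
  have hc : HasCompactSupport f := HasCompactSupport.of_compactSpace f
  exact hf.integrable_of_hasCompactSupport hc

/-- The integral of `F ∘ R θ` does not depend on `θ`, so its derivative, computed under the
integral, vanishes: infinitesimal rotations have divergence zero. -/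
theorem integral_deriv_rotate_eq_zero (R : ℝ → SO3) {F DF : S2 → ℝ} (hF : Continuous F)
    (hDF : Continuous DF)
    (h : ∀ z θ, HasDerivAt (fun θ => F (rotate (R θ) z)) (DF (rotate (R θ) z)) θ) :
    ∫ z, DF z ∂surface = 0 := by
  obtain ⟨C, hC⟩ := isCompact_univ.exists_bound_of_continuousOn hDF.continuousOn
  have hd := hasDerivAt_integral_of_dominated_loc_of_deriv_le (μ := surface)
    (F := fun θ z => F (rotate (R θ) z)) (F' := fun θ z => DF (rotate (R θ) z))
    (bound := fun _ => C) (x₀ := (0 : ℝ)) (s := Set.univ) univ_mem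
    (Eventually.of_forall fun θ => (hF.comp (continuous_rotate _)).aestronglyMeasurable)
    (integrable_surface_of_continuous (hF.comp (continuous_rotate _)))
    (hDF.comp (continuous_rotate _)).aestronglyMeasurable
    (Eventually.of_forall fun z θ _ => hC _ (Set.mem_univ _)) (integrable_const _)
    (Eventually.of_forall fun z θ _ => h z θ)
  have h1 := hd.2
  simp only [integral_rotate] at h1
  exact h1.unique (hasDerivAt_const _ _)

/-- Rotation by the angle `θ` in the `(i, j)` plane. The three cyclic orders give the three
generators of `SO(3)`, with consistent signs. -/
theorem exists_plane_rotation {i j k : Fin 3}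
    (hijk : (i, j, k) = (0, 1, 2) ∨ (i, j, k) = (1, 2, 0) ∨ (i, j, k) = (2, 0, 1)) :
    ∃ R : ℝ → SO3, ∀ (z : S2) (θ : ℝ),
      HasDerivAt (fun θ => (rotate (R θ) z : E3) i) (-(rotate (R θ) z : E3) j) θ ∧
      HasDerivAt (fun θ => (rotate (R θ) z : E3) j) ((rotate (R θ) z : E3) i) θ ∧
      HasDerivAt (fun θ => (rotate (R θ) z : E3) k) 0 θ := by
  let A : ℝ → Matrix (Fin 3) (Fin 3) ℝ := fun θ => Matrix.of fun a b =>
    if a = b then (if a = k then 1 else Real.cos θ)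
    else if a = i ∧ b = j then -Real.sin θ else if a = j ∧ b = i then Real.sin θ else 0
  have hA : ∀ θ, A θ ∈ Matrix.specialOrthogonalGroup (Fin 3) ℝ := by
    intro θ
    have hcs := Real.sin_sq_add_cos_sq θ
    refine Matrix.mem_specialUnitaryGroup_iff.2 ⟨Matrix.mem_unitaryGroup_iff.2 ?_, ?_⟩
    · rcases hijk with h | h | h <;> obtain ⟨rfl, rfl, rfl⟩ : _ ∧ _ ∧ _ := by simpa using h
      all_goals
        ext a b
        fin_cases a <;> fin_cases b <;>
          simp [A, Matrix.mul_apply, Fin.sum_univ_three, Matrix.star_apply] <;>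
          linarith
    · rcases hijk with h | h | h <;> obtain ⟨rfl, rfl, rfl⟩ : _ ∧ _ ∧ _ := by simpa using h
      all_goals
        rw [Matrix.det_fin_three]
        simp [A]
        nlinarith
  have hcoord : ∀ (z : S2) θ,
      (rotate ⟨A θ, hA θ⟩ z : E3) i = Real.cos θ * (z : E3) i + -Real.sin θ * (z : E3) j ∧
      (rotate ⟨A θ, hA θ⟩ z : E3) j = Real.sin θ * (z : E3) i + Real.cos θ * (z : E3) j ∧
      (rotate ⟨A θ, hA θ⟩ z : E3) k = (z : E3) k := by
    intro z θ
    simp only [rotate, Matrix.toLpLin_apply]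
    rcases hijk with h | h | h <;> obtain ⟨rfl, rfl, rfl⟩ : _ ∧ _ ∧ _ := by simpa using h
    all_goals
      refine ⟨?_, ?_, ?_⟩ <;>
        simp [A, Matrix.mulVec, dotProduct, Fin.sum_univ_three] <;> ring
  refine ⟨fun θ => ⟨A θ, hA θ⟩, fun z θ => ⟨?_, ?_, ?_⟩⟩
  · simp only [fun θ => (hcoord z θ).1, fun θ => (hcoord z θ).2.1]
    refine (((Real.hasDerivAt_cos θ).mul_const ((z : E3) i)).fun_add
      ((Real.hasDerivAt_sin θ).fun_neg.mul_const ((z : E3) j))).congr_deriv ?_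
    ring
  · simp only [fun θ => (hcoord z θ).1, fun θ => (hcoord z θ).2.1]
    exact ((Real.hasDerivAt_sin θ).mul_const ((z : E3) i)).fun_add
      ((Real.hasDerivAt_cos θ).mul_const ((z : E3) j))
  · simp only [fun θ => (hcoord z θ).2.2]
    exact hasDerivAt_const _ _

theorem continuous_coord (i : Fin 3) : Continuous (fun z : S2 => (z : E3) i) :=
  (EuclideanSpace.proj (𝕜 := ℝ) i).continuous.comp continuous_subtype_val

theorem continuous_inner_sphere (x : S2) :
    Continuous (fun z : S2 => inner ℝ (x : E3) (z : E3)) :=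
  (continuous_const.inner continuous_subtype_val)

theorem continuous_zonal (p : Polynomial ℝ) (x : S2) :
    Continuous (fun z : S2 => p.eval (inner ℝ (x : E3) (z : E3))) :=
  p.continuous.comp (continuous_inner_sphere x)

-- Integration by parts for one infinitesimal rotation, applied to `f(⟨x,w⟩) · A_x · g(⟨y,w⟩)`,
-- where `A_x = w_i x_j - w_j x_i` is the derivative of `⟨x,w⟩` along the rotation.
open Polynomial in
theorem integral_plane_rotation {i j k : Fin 3}
    (hijk : (i, j, k) = (0, 1, 2) ∨ (i, j, k) = (1, 2, 0) ∨ (i, j, k) = (2, 0, 1))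
    (f g : ℝ[X]) (x y : S2) :
    ∫ w : S2, ((derivative f).eval (inner ℝ (x : E3) (w : E3))
          * ((w : E3) i * (x : E3) j - (w : E3) j * (x : E3) i) ^ 2
        - f.eval (inner ℝ (x : E3) (w : E3))
          * ((w : E3) i * (x : E3) i + (w : E3) j * (x : E3) j))
          * g.eval (inner ℝ (y : E3) (w : E3))
        + f.eval (inner ℝ (x : E3) (w : E3)) * (derivative g).eval (inner ℝ (y : E3) (w : E3))
          * (((w : E3) i * (x : E3) j - (w : E3) j * (x : E3) i)
            * ((w : E3) i * (y : E3) j - (w : E3) j * (y : E3) i)) ∂surface = 0 := by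
  obtain ⟨R, hR⟩ := exists_plane_rotation hijk
  have hinner : ∀ u v : E3, inner ℝ u v = u i * v i + u j * v j + u k * v k := by
    intro u v
    rcases hijk with h | h | h <;> obtain ⟨rfl, rfl, rfl⟩ : _ ∧ _ ∧ _ := by simpa using h
    all_goals
      simp [PiLp.inner_apply, Fin.sum_univ_three]; ring
  have ci := continuous_coord i
  have cj := continuous_coord j
  have c1 := continuous_zonal f x
  have c2 := continuous_zonal (derivative f) x
  have c3 := continuous_zonal g y
  have c4 := continuous_zonal (derivative g) y
  refine integral_deriv_rotate_eq_zero R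
    (F := fun w : S2 => f.eval (inner ℝ (x : E3) (w : E3))
      * ((w : E3) i * (x : E3) j - (w : E3) j * (x : E3) i)
      * g.eval (inner ℝ (y : E3) (w : E3))) (by fun_prop) (by fun_prop) ?_
  intro z θ
  obtain ⟨hi, hj, hk⟩ := hR z θ
  have hin : ∀ v : S2, HasDerivAt (fun θ => inner ℝ (v : E3) (rotate (R θ) z : E3))
      ((rotate (R θ) z : E3) i * (v : E3) j - (rotate (R θ) z : E3) j * (v : E3) i) θ := by
    intro v
    simp only [hinner]
    refine (((hi.const_mul ((v : E3) i)).fun_add (hj.const_mul ((v : E3) j))).fun_add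
      (hk.const_mul ((v : E3) k))).congr_deriv ?_
    ring
  have hf := (f.hasDerivAt _).comp θ (hin x)
  have hg := (g.hasDerivAt _).comp θ (hin y)
  refine ((hf.fun_mul ((hi.mul_const ((x : E3) j)).fun_sub
    (hj.mul_const ((x : E3) i)))).fun_mul hg).congr_deriv ?_
  simp only [Function.comp]
  ring

open Polynomial in
/-- Green's identity for zonal functions. -/
theorem integral_zonal_laplacian (f g : ℝ[X]) (x y : S2) :
    ∫ w : S2, ((1 - X ^ 2) * derivative f - 2 * X * f).eval (inner ℝ (x : E3) (w : E3))
        * g.eval (inner ℝ (y : E3) (w : E3)) ∂surface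
      = - ∫ w : S2, f.eval (inner ℝ (x : E3) (w : E3))
        * (derivative g).eval (inner ℝ (y : E3) (w : E3))
        * (inner ℝ (x : E3) (y : E3)
          - inner ℝ (x : E3) (w : E3) * inner ℝ (y : E3) (w : E3)) ∂surface := by
  have h1 := integral_plane_rotation (i := 0) (j := 1) (k := 2) (by simp) f g x y
  have h2 := integral_plane_rotation (i := 1) (j := 2) (k := 0) (by simp) f g x y
  have h3 := integral_plane_rotation (i := 2) (j := 0) (k := 1) (by simp) f g x y
  have c0 := continuous_coord 0
  have ca := continuous_coord 1
  have cb := continuous_coord 2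
  have c1 := continuous_zonal f x
  have c2 := continuous_zonal (derivative f) x
  have c3 := continuous_zonal g y
  have c4 := continuous_zonal (derivative g) y
  have c5 := continuous_inner_sphere x
  have c6 := continuous_inner_sphere y
  have c7 := continuous_zonal ((1 - X ^ 2) * derivative f - 2 * X * f) x
  rw [eq_neg_iff_add_eq_zero, ← integral_add
    (integrable_surface_of_continuous (by fun_prop))
    (integrable_surface_of_continuous (by fun_prop))]
  -- The three generators add up to the Laplacian, so the three planar identities are summed.
  have h12 := congrArg₂ (· + ·) (congrArg₂ (· + ·) h1 h2) h3
  rw [← integral_add (integrable_surface_of_continuous (by fun_prop))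
    (integrable_surface_of_continuous (by fun_prop)),
    ← integral_add (integrable_surface_of_continuous (by fun_prop))
    (integrable_surface_of_continuous (by fun_prop))] at h12
  simp only [add_zero] at h12
  rw [← h12]
  refine integral_congr_ae (Eventually.of_forall fun w => ?_)
  simp only [eval_sub, eval_mul, eval_pow, eval_X, eval_one, eval_ofNat]
  have hin : ∀ u v : E3, inner ℝ u v = u 0 * v 0 + u 1 * v 1 + u 2 * v 2 := by
    intro u v
    simp [PiLp.inner_apply, Fin.sum_univ_three]; ring
  have hx : (x : E3) 0 * (x : E3) 0 + (x : E3) 1 * (x : E3) 1 + (x : E3) 2 * (x : E3) 2 = 1 := by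
    rw [← hin, real_inner_self_eq_norm_sq]; simp
  have hw : (w : E3) 0 * (w : E3) 0 + (w : E3) 1 * (w : E3) 1 + (w : E3) 2 * (w : E3) 2 = 1 := by
    rw [← hin, real_inner_self_eq_norm_sq]; simp
  -- `e1` is Lagrange's identity for `|w × x|²`, and `e2` is the Binet–Cauchy identity for `(w × x)
  -- · (w × y)`, both using `|w| = 1`.
  have e1 : 1 - inner ℝ (x : E3) (w : E3) ^ 2
      = ((w : E3) 0 * (x : E3) 1 - (w : E3) 1 * (x : E3) 0) ^ 2
        + ((w : E3) 1 * (x : E3) 2 - (w : E3) 2 * (x : E3) 1) ^ 2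
        + ((w : E3) 2 * (x : E3) 0 - (w : E3) 0 * (x : E3) 2) ^ 2 := by
    rw [hin]
    linear_combination -hx - ((x : E3) 0 * (x : E3) 0 + (x : E3) 1 * (x : E3) 1
      + (x : E3) 2 * (x : E3) 2) * hw
  have e2 : inner ℝ (x : E3) (y : E3)
        - inner ℝ (x : E3) (w : E3) * inner ℝ (y : E3) (w : E3)
      = ((w : E3) 0 * (x : E3) 1 - (w : E3) 1 * (x : E3) 0)
          * ((w : E3) 0 * (y : E3) 1 - (w : E3) 1 * (y : E3) 0)
        + ((w : E3) 1 * (x : E3) 2 - (w : E3) 2 * (x : E3) 1)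
          * ((w : E3) 1 * (y : E3) 2 - (w : E3) 2 * (y : E3) 1)
        + ((w : E3) 2 * (x : E3) 0 - (w : E3) 0 * (x : E3) 2)
          * ((w : E3) 2 * (y : E3) 0 - (w : E3) 0 * (y : E3) 2) := by
    simp only [hin]
    linear_combination -((x : E3) 0 * (y : E3) 0 + (x : E3) 1 * (y : E3) 1
      + (x : E3) 2 * (y : E3) 2) * hw
  rw [e1, e2]
  generalize hc : eval (inner ℝ (x : E3) (w : E3)) f = p
  generalize eval (inner ℝ (x : E3) (w : E3)) (derivative f) = p'
  generalize eval (inner ℝ (y : E3) (w : E3)) g = q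
  generalize eval (inner ℝ (y : E3) (w : E3)) (derivative g) = q'
  rw [hin]
  ring

-- Green's identity with `f = Q_l'` and `g = Q_m` writes `μ_l` times the integral as an expression
-- symmetric under exchange of `(l, x)` and `(m, y)`; so `μ_l - μ_m` times the integral is zero. The
-- two centres may differ, as covariances between different points require.
open Polynomial in
theorem integral_legendre_mul_legendre {l m : ℕ} (hlm : l ≠ m) (x y : S2) :
    ∫ w : S2, (legendre l).eval (inner ℝ (x : E3) (w : E3))
      * (legendre m).eval (inner ℝ (y : E3) (w : E3)) ∂surface = 0 := by
  have key : ∀ (l m : ℕ) (x y : S2),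
      eigen l * ∫ w : S2, (legendre l).eval (inner ℝ (x : E3) (w : E3))
        * (legendre m).eval (inner ℝ (y : E3) (w : E3)) ∂surface
      = ∫ w : S2, (derivative (legendre l)).eval (inner ℝ (x : E3) (w : E3))
        * (derivative (legendre m)).eval (inner ℝ (y : E3) (w : E3))
        * (inner ℝ (x : E3) (y : E3)
          - inner ℝ (x : E3) (w : E3) * inner ℝ (y : E3) (w : E3)) ∂surface := by
    intro l m x y
    have h := integral_zonal_laplacian (derivative (legendre l)) (legendre m) x y
    have e : (1 - X ^ 2) * derivative (derivative (legendre l)) - 2 * X * derivative (legendre l)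
        = C (-eigen l) * legendre l := by
      rw [C_neg]
      linear_combination -legendre_ode l
    rw [e] at h
    simp only [eval_mul, eval_C, mul_assoc] at h
    rw [integral_const_mul] at h
    simp only [mul_assoc]
    linarith
  have h1 := key l m x y
  have h2 := key m l y x
  have h3 : eigen l ≠ eigen m := fun h => hlm (eigen_injective h)
  have h4 : ∫ w : S2, (legendre m).eval (inner ℝ (y : E3) (w : E3))
      * (legendre l).eval (inner ℝ (x : E3) (w : E3)) ∂surface
      = ∫ w : S2, (legendre l).eval (inner ℝ (x : E3) (w : E3))
      * (legendre m).eval (inner ℝ (y : E3) (w : E3)) ∂surface := by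
    simp only [mul_comm]
  have h5 : ∫ w : S2, (derivative (legendre m)).eval (inner ℝ (y : E3) (w : E3))
        * (derivative (legendre l)).eval (inner ℝ (x : E3) (w : E3))
        * (inner ℝ (y : E3) (x : E3)
          - inner ℝ (y : E3) (w : E3) * inner ℝ (x : E3) (w : E3)) ∂surface
      = ∫ w : S2, (derivative (legendre l)).eval (inner ℝ (x : E3) (w : E3))
        * (derivative (legendre m)).eval (inner ℝ (y : E3) (w : E3))
        * (inner ℝ (x : E3) (y : E3)
          - inner ℝ (x : E3) (w : E3) * inner ℝ (y : E3) (w : E3)) ∂surface := by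
    refine integral_congr_ae (Eventually.of_forall fun w => ?_)
    simp only [real_inner_comm (x : E3) (y : E3)]
    ring
  rw [h4, h5, ← h1] at h2
  have h6 : (eigen l - eigen m) * ∫ w : S2, (legendre l).eval (inner ℝ (x : E3) (w : E3))
      * (legendre m).eval (inner ℝ (y : E3) (w : E3)) ∂surface = 0 := by linarith
  exact (mul_eq_zero.1 h6).resolve_left (sub_ne_zero.2 h3)

end SphereField

/-! ### Gaussian subspaces of `L²` -/

namespace GaussianHilbert

variable {Ω : Type*} [mΩ : MeasurableSpace Ω] {P : Measure Ω}

theorem inner_eq_integral (f g : Lp ℝ 2 P) : inner ℝ f g = ∫ ω, f ω * g ω ∂P := by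
  rw [L2.inner_def]
  exact integral_congr_ae (Eventually.of_forall fun ω => by simp [mul_comm])

theorem norm_sq_eq_integral (f : Lp ℝ 2 P) : ‖f‖ ^ 2 = ∫ ω, f ω ^ 2 ∂P := by
  rw [← real_inner_self_eq_norm_sq, inner_eq_integral]
  simp only [pow_two]

/-- Elements of `L²` with a centred Gaussian law. -/
def IsCenteredGaussian (Z : Lp ℝ 2 P) : Prop := P.map Z = gaussianReal 0 (‖Z‖₊ ^ 2)

theorem aemeasurable_coe (Z : Lp ℝ 2 P) : AEMeasurable Z P :=
  (Lp.stronglyMeasurable Z).measurable.aemeasurable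

theorem integral_abs_le_norm [IsProbabilityMeasure P] (Z : Lp ℝ 2 P) : ∫ ω, |Z ω| ∂P ≤ ‖Z‖ := by
  have h1 : ∫ ω, |Z ω| ∂P = (eLpNorm Z 1 P).toReal := by
    rw [eLpNorm_one_eq_lintegral_enorm, ← integral_norm_eq_lintegral_enorm
      (Lp.aestronglyMeasurable Z)]
    simp only [Real.norm_eq_abs]
  rw [h1, Lp.norm_def]
  exact ENNReal.toReal_mono (Lp.eLpNorm_ne_top Z)
    (eLpNorm_le_eLpNorm_of_exponent_le (by norm_num) (Lp.aestronglyMeasurable Z))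

theorem isCenteredGaussian_iff [IsProbabilityMeasure P] (Z : Lp ℝ 2 P) :
    IsCenteredGaussian Z ↔
      ∀ t : ℝ, ∫ ω, Complex.exp (t * Z ω * Complex.I) ∂P = Complex.exp (-(‖Z‖ ^ 2 * t ^ 2 / 2)) := by
  have hc : ∀ t : ℝ, charFun (P.map Z) t = ∫ ω, Complex.exp (t * Z ω * Complex.I) ∂P := by
    intro t
    rw [charFun_apply_real, integral_map (aemeasurable_coe Z)]
    exact (Continuous.aestronglyMeasurable (by fun_prop))
  have hg : ∀ t : ℝ, charFun (gaussianReal 0 (‖Z‖₊ ^ 2)) t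
      = Complex.exp (-(‖Z‖ ^ 2 * t ^ 2 / 2)) := by
    intro t
    rw [charFun_gaussianReal]
    simp
  have : IsProbabilityMeasure (P.map Z) := Measure.isProbabilityMeasure_map (aemeasurable_coe Z)
  constructor
  · intro h t
    rw [← hc, ← hg, h]
  · intro h
    refine Measure.ext_of_charFun (funext fun t => ?_)
    rw [hc, hg, h]

theorem integrable_cexp [IsProbabilityMeasure P] (t : ℝ) (Z : Lp ℝ 2 P) :
    Integrable (fun ω => Complex.exp (t * Z ω * Complex.I)) P := by
  refine Integrable.of_bound (C := 1) ?_ (Eventually.of_forall fun ω => ?_)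
  · exact (Continuous.comp_aestronglyMeasurable (g := fun x : ℝ => Complex.exp (t * x * Complex.I))
      (by fun_prop) (Lp.aestronglyMeasurable Z))
  · rw [← Complex.ofReal_mul, Complex.norm_exp_ofReal_mul_I]

theorem continuous_integral_cexp [IsProbabilityMeasure P] (t : ℝ) :
    Continuous fun Z : Lp ℝ 2 P => ∫ ω, Complex.exp (t * Z ω * Complex.I) ∂P := by
  have : LipschitzWith ⟨|t|, abs_nonneg t⟩
      fun Z : Lp ℝ 2 P => ∫ ω, Complex.exp (t * Z ω * Complex.I) ∂P := by
    refine LipschitzWith.of_dist_le_mul fun Z W => ?_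
    rw [dist_eq_norm, dist_eq_norm, ← integral_sub (integrable_cexp t Z) (integrable_cexp t W)]
    calc ‖∫ ω, (Complex.exp (t * Z ω * Complex.I) - Complex.exp (t * W ω * Complex.I)) ∂P‖
        ≤ ∫ ω, ‖Complex.exp (t * Z ω * Complex.I) - Complex.exp (t * W ω * Complex.I)‖ ∂P :=
          norm_integral_le_integral_norm _
      _ ≤ ∫ ω, |t| * |(Z - W : Lp ℝ 2 P) ω| ∂P := by
          refine integral_mono_ae ((integrable_cexp t Z).sub (integrable_cexp t W)).norm
            ((((Lp.memLp (Z - W)).integrable (by norm_num)).abs).const_mul _) ?_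
          filter_upwards [Lp.coeFn_sub Z W] with ω hω
          rw [hω]
          have e : Complex.exp (t * Z ω * Complex.I) - Complex.exp (t * W ω * Complex.I)
              = Complex.exp ((t * W ω : ℝ) * Complex.I)
                * (Complex.exp (Complex.I * (t * (Z ω - W ω) : ℝ)) - 1) := by
            rw [mul_sub, ← Complex.exp_add]
            push_cast
            ring_nf
          rw [e, norm_mul, Complex.norm_exp_ofReal_mul_I, one_mul]
          refine Real.norm_exp_I_mul_ofReal_sub_one_le.trans ?_
          simp
      _ = |t| * ∫ ω, |(Z - W : Lp ℝ 2 P) ω| ∂P := integral_const_mul _ _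
      _ ≤ |t| * ‖Z - W‖ := by gcongr; exact integral_abs_le_norm _
  exact this.continuous

/-- Gaussianity is a family of equations between `E e^{itZ}` and a function of `‖Z‖`, and both sides
are continuous in `L²`. -/
theorem isClosed_isCenteredGaussian [IsProbabilityMeasure P] : IsClosed {Z : Lp ℝ 2 P | IsCenteredGaussian Z} := by
  simp only [isCenteredGaussian_iff, Set.ofPred_forall]
  exact isClosed_iInter fun t => isClosed_eq (continuous_integral_cexp t) (by fun_prop)

theorem isCenteredGaussian_of_hasGaussianLaw {Z : Lp ℝ 2 P} (hZ : HasGaussianLaw Z P)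
    (h0 : ∫ ω, Z ω ∂P = 0) : IsCenteredGaussian Z := by
  rw [IsCenteredGaussian, hZ.map_eq_gaussianReal, h0, variance_of_integral_eq_zero
    hZ.aemeasurable h0]
  congr 1
  apply NNReal.eq
  rw [Real.coe_toNNReal _ (integral_nonneg fun ω => by positivity)]
  simp only [NNReal.coe_pow, coe_nnnorm]
  rw [norm_sq_eq_integral]

namespace IsCenteredGaussian

variable {Z : Lp ℝ 2 P}

theorem map_eq_map_mul (hZ : IsCenteredGaussian Z) :
    P.map Z = (gaussianReal 0 1).map (‖Z‖ * ·) := by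
  rw [hZ, gaussianReal_map_const_mul, mul_zero]
  congr 1
  apply NNReal.eq
  simp

theorem memLp (hZ : IsCenteredGaussian Z) {p : ℝ≥0∞} (hp : p ≠ ∞) : MemLp Z p P := by
  have h := memLp_id_gaussianReal' (μ := 0) (v := ‖Z‖₊ ^ 2) p hp
  rw [← hZ] at h
  exact h.comp_of_map (aemeasurable_coe Z)

/-- `Z` has the law of `‖Z‖` times a standard normal variable. So `L²` convergence alone gives
convergence of all moments, and equality of norms gives equality of moments. -/
theorem integral_pow (hZ : IsCenteredGaussian Z) (n : ℕ) :
    ∫ ω, Z ω ^ n ∂P = ‖Z‖ ^ n * ∫ x, x ^ n ∂(gaussianReal 0 1) := by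
  have h1 : ∫ ω, Z ω ^ n ∂P = ∫ x, x ^ n ∂(P.map Z) := by
    rw [integral_map (aemeasurable_coe Z) (Continuous.aestronglyMeasurable (by fun_prop))]
  rw [h1, hZ.map_eq_map_mul, integral_map (by fun_prop)
    (Continuous.aestronglyMeasurable (by fun_prop)), ← integral_const_mul]
  simp only [mul_pow]

theorem integral_pow_nonneg (hZ : IsCenteredGaussian Z) (n : ℕ) : 0 ≤ ∫ ω, Z ω ^ n ∂P := by
  rcases n.even_or_odd with hn | hn
  · exact integral_nonneg fun ω => hn.pow_nonneg _
  · rw [hZ.integral_pow]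
    have h1 : ∫ x, x ^ n ∂(gaussianReal 0 1) = - ∫ x, x ^ n ∂(gaussianReal 0 1) := by
      conv_lhs => rw [show gaussianReal 0 1 = (gaussianReal 0 1).map (fun x => -x) by
        rw [gaussianReal_map_neg, neg_zero]]
      rw [integral_map (by fun_prop) (Continuous.aestronglyMeasurable (by fun_prop))]
      simp only [hn.neg_pow, integral_neg]
    rw [show ∫ x, x ^ n ∂(gaussianReal 0 1) = 0 by linarith, mul_zero]

theorem integral_eq_zero (hZ : IsCenteredGaussian Z) : ∫ ω, Z ω ∂P = 0 := by
  have h1 : ∫ ω, Z ω ∂P = ∫ x, x ∂(P.map Z) := by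
    rw [integral_map (aemeasurable_coe Z) (Continuous.aestronglyMeasurable (by fun_prop))]
  rw [h1, hZ, integral_id_gaussianReal]

end IsCenteredGaussian

/-- Every linear functional of the vector is again an element of `H`, hence Gaussian, which is joint
Gaussianity. -/
theorem hasGaussianLaw_of_forall_mem {H : Submodule ℝ (Lp ℝ 2 P)}
    (hH : ∀ Z ∈ H, IsCenteredGaussian Z) {ι : Type*} [Finite ι] (Z : ι → Lp ℝ 2 P)
    (hZ : ∀ i, Z i ∈ H) : HasGaussianLaw (fun ω i => Z i ω) P := by
  classical
  cases nonempty_fintype ι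
  have hm : AEMeasurable (fun ω i => Z i ω) P := aemeasurable_pi_lambda _ fun i => aemeasurable_coe _
  refine ⟨isGaussian_of_map_eq_gaussianReal fun L => ⟨0, ‖∑ i, L (Pi.single i 1) • Z i‖₊ ^ 2, ?_⟩⟩
  rw [← hH (∑ i, L (Pi.single i 1) • Z i)
    (H.sum_mem fun i _ => H.smul_mem _ (hZ i)),
    AEMeasurable.map_map_of_aemeasurable (by fun_prop) hm]
  refine Measure.map_congr ?_
  have h1 : ∀ᵐ ω ∂P, ∀ i, (L (Pi.single i 1) • Z i : Lp ℝ 2 P) ω = L (Pi.single i 1) * Z i ω :=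
    ae_all_iff.2 fun i => by
      filter_upwards [Lp.coeFn_smul (L (Pi.single i 1)) (Z i)] with ω hω
      rw [hω]; rfl
  filter_upwards [h1, Lp.coeFn_finsetSum (s := Finset.univ)
    (f := fun i => L (Pi.single i 1) • Z i)] with ω h1 h2
  rw [h2, Finset.sum_apply]
  simp only [h1, Function.comp]
  conv_lhs => rw [← Finset.univ_sum_single (fun i => Z i ω)]
  rw [map_sum]
  refine Finset.sum_congr rfl fun i _ => ?_
  rw [show Pi.single i (Z i ω) = Z i ω • (Pi.single i 1 : ι → ℝ) by
    rw [← Pi.single_smul, smul_eq_mul, mul_one], map_smul, smul_eq_mul, mul_comm]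

theorem integrable_prod [IsProbabilityMeasure P] {n : ℕ} (Z : Fin n → Lp ℝ 2 P) (hZ : ∀ j, IsCenteredGaussian (Z j)) :
    Integrable (fun ω => ∏ j, Z j ω) P := by
  rcases Nat.eq_zero_or_pos n with rfl | hn
  · simp
  -- Hölder with `n` exponents all equal to `n`, whose reciprocals sum to one.
  have h := MemLp.prod' (s := Finset.univ) (f := fun j => (Z j : Ω → ℝ)) (p := fun _ => (n : ℝ≥0∞))
    (μ := P) fun j _ => (hZ j).memLp (ENNReal.natCast_ne_top n)
  simp only [Finset.sum_const, Finset.card_univ, Fintype.card_fin, nsmul_eq_mul] at h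
  rw [ENNReal.mul_inv_cancel (by exact_mod_cast hn.ne') (ENNReal.natCast_ne_top n), inv_one] at h
  exact memLp_one_iff_integrable.1 h

/-- Collecting equal indices leaves powers of distinct, jointly Gaussian, orthogonal and hence
independent variables. The expectation factors, and each moment is nonnegative: even ones clearly,
odd ones because they vanish. -/
theorem integral_prod_nonneg [IsProbabilityMeasure P] {H : Submodule ℝ (Lp ℝ 2 P)}
    (hH : ∀ Z ∈ H, IsCenteredGaussian Z) {Z : ℕ → Lp ℝ 2 P} (hZ : ∀ l, Z l ∈ H)
    (horth : ∀ l m, l ≠ m → inner ℝ (Z l) (Z m) = 0) {n : ℕ} (l : Fin n → ℕ) :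
    0 ≤ ∫ ω, ∏ j, Z (l j) ω ∂P := by
  classical
  set s : Finset ℕ := Finset.univ.image l with hs
  have hG := hasGaussianLaw_of_forall_mem hH (fun i : s => Z i) fun i => hZ i
  have hindep : iIndepFun (fun (i : s) ω => Z i ω) P := by
    refine hG.iIndepFun_of_covariance_eq_zero fun i j hij => ?_
    rw [covariance_eq_sub (Lp.memLp _) (Lp.memLp _), (hH _ (hZ i)).integral_eq_zero, zero_mul,
      sub_zero, ← horth i j (fun h => hij (Subtype.ext h)), inner_eq_integral]
    rfl
  have e : ∀ ω, ∏ j, Z (l j) ω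
      = ∏ i : s, Z i ω ^ (Finset.univ.filter fun j => l j = i).card := by
    intro ω
    rw [Finset.prod_comp (fun k => Z k ω) l, ← hs, ← Finset.prod_coe_sort s]
  simp only [e]
  have h2 := hindep.comp (g := fun i x => x ^ (Finset.univ.filter fun j => l j = (i : ℕ)).card)
    fun i => by fun_prop
  have h3 := h2.integral_fun_prod_eq_prod_integral fun i =>
    ((Lp.stronglyMeasurable (Z i)).measurable.pow_const _).aestronglyMeasurable
  simp only [Function.comp_apply] at h3
  rw [h3]
  exact Finset.prod_nonneg fun i _ => (hH _ (hZ i)).integral_pow_nonneg _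

/-- Finite linear combinations are Gaussian by definition of a Gaussian process; the closure follows
because the Gaussian elements form a closed set. -/
theorem isCenteredGaussian_of_mem_closure_span [IsProbabilityMeasure P] {S : Type*} {X : S → Ω → ℝ}
    (hX : IsGaussianProcess X P) (h0 : ∀ s, ∫ ω, X s ω ∂P = 0) {τ : S → Lp ℝ 2 P}
    (hτ : ∀ s, τ s =ᵐ[P] X s) :
    ∀ Z ∈ (Submodule.span ℝ (Set.range τ)).topologicalClosure, IsCenteredGaussian Z := by
  have hspan : ∀ Z ∈ Submodule.span ℝ (Set.range τ), IsCenteredGaussian Z := by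
    intro Z hZ
    obtain ⟨c, rfl⟩ := Finsupp.mem_span_range_iff_exists_finsupp.1 hZ
    have hae : (c.sum fun i a => a • τ i : Lp ℝ 2 P)
        =ᵐ[P] fun ω => ∑ i : c.support, c i * X i ω := by
      have h1 : ∀ᵐ ω ∂P, ∀ i ∈ c.support, (c i • τ i : Lp ℝ 2 P) ω = c i * X i ω :=
        (c.support.eventually_all).2 fun i _ => by
          filter_upwards [Lp.coeFn_smul (c i) (τ i), hτ i] with ω hω h2
          rw [hω, Pi.smul_apply, h2, smul_eq_mul]
      filter_upwards [h1, Lp.coeFn_finsetSum (s := c.support)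
        (f := fun i => c i • τ i)] with ω h1 h2
      rw [Finsupp.sum, h2, Finset.sum_apply, Finset.sum_coe_sort c.support (fun i => c i * X i ω)]
      exact Finset.sum_congr rfl h1
    refine isCenteredGaussian_of_hasGaussianLaw ?_ ?_
    · let L : (c.support → ℝ) →L[ℝ] ℝ :=
        ∑ i : c.support, c i • ContinuousLinearMap.proj (R := ℝ) (φ := fun _ : c.support => ℝ) i
      have h := (hX.hasGaussianLaw c.support).map_fun L
      refine h.congr (hae.symm.mono fun ω hω => ?_)
      rw [← hω]
      simp [L, Finset.restrict]
    · have hint : ∀ i : c.support, Integrable (fun ω => c i * X i ω) P := fun i =>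
        ((hX.hasGaussianLaw_eval (i : S)).integrable).const_mul _
      rw [integral_congr_ae hae, integral_finsetSum Finset.univ fun i _ => hint i]
      simp [integral_const_mul, h0]
  intro Z hZ
  exact (isClosed_isCenteredGaussian.closure_subset_iff.2 hspan) hZ

end GaussianHilbert

/-- Cauchy–Schwarz over the finite measure `ρ`, then Tonelli. -/
theorem MeasureTheory.MemLp.integral_prod_left_two {S Ω : Type*} [MeasurableSpace S]
    [MeasurableSpace Ω] {ρ : Measure S} {P : Measure Ω} [IsFiniteMeasure ρ] [SFinite P]
    {f : S × Ω → ℝ} (hf : MemLp f 2 (ρ.prod P)) (hfm : StronglyMeasurable f) :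
    MemLp (fun ω => ∫ z, f (z, ω) ∂ρ) 2 P := by
  have hm : StronglyMeasurable fun ω => ∫ z, f (z, ω) ∂ρ := hfm.integral_prod_left'
  refine ⟨hm.aestronglyMeasurable, ?_⟩
  rw [eLpNorm_lt_top_iff_lintegral_rpow_enorm_lt_top two_ne_zero ENNReal.ofNat_ne_top]
  have h2 : ∫⁻ p, ‖f p‖ₑ ^ (2 : ℝ) ∂(ρ.prod P) < ∞ := by
    have := (eLpNorm_lt_top_iff_lintegral_rpow_enorm_lt_top two_ne_zero
      ENNReal.ofNat_ne_top).1 hf.2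
    simpa using this
  rw [lintegral_prod_symm' _ (by fun_prop)] at h2
  simp only [ENNReal.toReal_ofNat]
  have hb : ∀ ω, ‖∫ z, f (z, ω) ∂ρ‖ₑ ^ (2 : ℝ)
      ≤ ρ Set.univ * ∫⁻ z, ‖f (z, ω)‖ₑ ^ (2 : ℝ) ∂ρ := by
    intro ω
    have h1 : ‖∫ z, f (z, ω) ∂ρ‖ₑ ≤ ∫⁻ z, ‖f (z, ω)‖ₑ ∂ρ := enorm_integral_le_lintegral_enorm _
    have h3 := ENNReal.lintegral_mul_le_Lp_mul_Lq (p := 2) (q := 2) ρ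
      (by constructor <;> norm_num) (f := fun z => ‖f (z, ω)‖ₑ) (g := fun _ => 1)
      (by fun_prop) (by fun_prop)
    simp only [Pi.mul_apply, mul_one, ENNReal.one_rpow, lintegral_const, one_mul] at h3
    calc ‖∫ z, f (z, ω) ∂ρ‖ₑ ^ (2 : ℝ)
        ≤ ((∫⁻ z, ‖f (z, ω)‖ₑ ^ (2 : ℝ) ∂ρ) ^ ((1 : ℝ) / 2)
            * (ρ Set.univ) ^ ((1 : ℝ) / 2)) ^ (2 : ℝ) :=
          ENNReal.rpow_le_rpow (h1.trans h3) (by norm_num)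
      _ = ρ Set.univ * ∫⁻ z, ‖f (z, ω)‖ₑ ^ (2 : ℝ) ∂ρ := by
          rw [ENNReal.mul_rpow_of_nonneg _ _ (by norm_num), ← ENNReal.rpow_mul,
            ← ENNReal.rpow_mul]
          norm_num [mul_comm]
  refine (lintegral_mono hb).trans_lt ?_
  rw [lintegral_const_mul' _ _ (measure_ne_top ρ _)]
  exact ENNReal.mul_lt_top (measure_lt_top ρ _) h2

/-! ### The field as a map into `L²`, and its averages over the sphere. -/

namespace SphereField

/-- The north pole. -/
noncomputable def northPole : S2 := ⟨EuclideanSpace.single 2 1, by simp⟩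

/-- The zonal function `z ↦ q ⟨x, z⟩`, depending continuously on `x`. -/
noncomputable def zonal (q : Polynomial ℝ) : C(S2, C(S2, ℝ)) :=
  ContinuousMap.curry ⟨fun p : S2 × S2 => q.eval (inner ℝ (p.1 : E3) (p.2 : E3)), by
    exact q.continuous.comp (by fun_prop)⟩

theorem zonal_apply (q : Polynomial ℝ) (x z : S2) :
    zonal q x z = q.eval (inner ℝ (x : E3) (z : E3)) := rfl

theorem zonal_rotate (q : Polynomial ℝ) (g : SO3) (x z : S2) :
    zonal q (rotate g x) (rotate g z) = zonal q x z := by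
  rw [zonal_apply, zonal_apply, inner_rotate]

theorem zonal_comm (q : Polynomial ℝ) (x z : S2) : zonal q x z = zonal q z x := by
  rw [zonal_apply, zonal_apply, real_inner_comm]

open GaussianHilbert

section Field

variable {Ω : Type*} [mΩ : MeasurableSpace Ω] {P : Measure Ω} {T : S2 → Ω → ℝ}

namespace IsIsotropicGaussianField

theorem memLp (hT : IsIsotropicGaussianField P T) (x : S2) : MemLp (T x) 2 P :=
  (hT.gaussian.hasGaussianLaw_eval x).memLp_two

/-- The field as a map into `L²`. -/
noncomputable def toL2 (hT : IsIsotropicGaussianField P T) (x : S2) : Lp ℝ 2 P :=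
  (hT.memLp x).toLp

theorem coeFn_toL2 (hT : IsIsotropicGaussianField P T) (x : S2) : hT.toL2 x =ᵐ[P] T x :=
  (hT.memLp x).coeFn_toLp

theorem inner_toL2 (hT : IsIsotropicGaussianField P T) (x y : S2) :
    inner ℝ (hT.toL2 x) (hT.toL2 y) = ∫ ω, T x ω * T y ω ∂P := by
  rw [inner_eq_integral]
  refine integral_congr_ae ?_
  filter_upwards [hT.coeFn_toL2 x, hT.coeFn_toL2 y] with ω h1 h2
  rw [h1, h2]

theorem inner_toL2_rotate (hT : IsIsotropicGaussianField P T) (g : SO3) (x y : S2) :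
    inner ℝ (hT.toL2 (rotate g x)) (hT.toL2 (rotate g y))
      = inner ℝ (hT.toL2 x) (hT.toL2 y) := by
  rw [inner_toL2, inner_toL2]
  exact ((hT.isotropic g).comp (u := fun f : S2 → ℝ => f x * f y)
    ((measurable_pi_apply x).mul (measurable_pi_apply y))).integral_eq

theorem norm_toL2 (hT : IsIsotropicGaussianField P T) (x : S2) :
    ‖hT.toL2 x‖ = ‖hT.toL2 northPole‖ := by
  obtain ⟨g, hg, -⟩ := exists_rotate_swap northPole x
  have h := hT.inner_toL2_rotate g northPole northPole
  rw [hg, real_inner_self_eq_norm_sq, real_inner_self_eq_norm_sq] at h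
  exact (sq_eq_sq₀ (norm_nonneg _) (norm_nonneg _)).1 h

theorem inner_toL2_right (hT : IsIsotropicGaussianField P T) (Z : Lp ℝ 2 P) (z : S2) :
    inner ℝ Z (hT.toL2 z) = ∫ ω, Z ω * T z ω ∂P := by
  rw [inner_eq_integral]
  refine integral_congr_ae ?_
  filter_upwards [hT.coeFn_toL2 z] with ω hω
  rw [hω]

/-- The closed linear span of the field in `L²`. -/
noncomputable def space (hT : IsIsotropicGaussianField P T) : Submodule ℝ (Lp ℝ 2 P) :=
  (Submodule.span ℝ (Set.range hT.toL2)).topologicalClosure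

theorem toL2_mem_space (hT : IsIsotropicGaussianField P T) (x : S2) : hT.toL2 x ∈ hT.space :=
  Submodule.le_topologicalClosure _ (Submodule.subset_span ⟨x, rfl⟩)

/-- Identities in the span can thus be tested on covariances with the field. -/
theorem eq_zero_of_mem_of_inner_toL2 (hT : IsIsotropicGaussianField P T) {Z : Lp ℝ 2 P}
    (hZ : Z ∈ hT.space) (h : ∀ x, inner ℝ Z (hT.toL2 x) = 0) : Z = 0 := by
  have hZ' : Z ∈ hT.spaceᗮ := by
    rw [space, Submodule.orthogonal_closure, Submodule.mem_orthogonal']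
    intro u hu
    induction hu using Submodule.span_induction with
    | mem u hu => obtain ⟨x, rfl⟩ := hu; exact h x
    | zero => exact inner_zero_right _
    | add u v _ _ hu hv => rw [inner_add_right, hu, hv, add_zero]
    | smul c u _ hu => rw [inner_smul_right, hu, mul_zero]
  exact inner_self_eq_zero.1 (Submodule.inner_right_of_mem_orthogonal hZ hZ')

/-- Measurability with respect to `𝔉_T` is a closed condition in `L²`. This route matters because
joint measurability of `T` is assumed for `𝓖` and not for `𝔉_T`, so averages of `T` are not visibly
`𝔉_T`-measurable. -/
theorem aestronglyMeasurable_of_mem_space (hT : IsIsotropicGaussianField P T)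
    {Z : Lp ℝ 2 P} (hZ : Z ∈ hT.space) : AEStronglyMeasurable[fieldSigma T] Z P := by
  have hle : fieldSigma T ≤ mΩ := iSup_le fun x =>
    (hT.measurable.comp measurable_prodMk_left).comap_le
  have hsub : Submodule.span ℝ (Set.range hT.toL2) ≤ lpMeas ℝ ℝ (fieldSigma T) 2 P := by
    rw [Submodule.span_le]
    rintro _ ⟨x, rfl⟩
    rw [SetLike.mem_coe, mem_lpMeas_iff_aestronglyMeasurable]
    have hx : Measurable[fieldSigma T] (T x) :=
      Measurable.mono (comap_measurable (T x)) (le_iSup (fun x => MeasurableSpace.comap (T x) _) x)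
        le_rfl
    exact ⟨T x, hx.stronglyMeasurable, hT.coeFn_toL2 x⟩
  have hcl : IsClosed {f : Lp ℝ 2 P | AEStronglyMeasurable[fieldSigma T] f P} :=
    isClosed_aestronglyMeasurable hle
  exact hcl.closure_subset_iff.2 (fun f hf => mem_lpMeas_iff_aestronglyMeasurable.1 (hsub hf)) hZ

variable [IsProbabilityMeasure P]

theorem memLp_uncurry (hT : IsIsotropicGaussianField P T) (ρ : Measure S2) [IsFiniteMeasure ρ] :
    MemLp (fun p : S2 × Ω => T p.1 p.2) 2 (ρ.prod P) := by
  have hm := hT.measurable.aestronglyMeasurable (μ := ρ.prod P)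
  rw [memLp_two_iff_integrable_sq hm, integrable_prod_iff (by exact hm.pow 2)]
  refine ⟨Eventually.of_forall fun z => (hT.memLp z).integrable_sq, ?_⟩
  have h : ∀ z, ∫ ω, ‖T z ω ^ 2‖ ∂P = ‖hT.toL2 northPole‖ ^ 2 := by
    intro z
    rw [← hT.norm_toL2 z, ← real_inner_self_eq_norm_sq, hT.inner_toL2]
    refine integral_congr_ae (Eventually.of_forall fun ω => ?_)
    simp [pow_two]
  simp only [h]
  exact integrable_const _

theorem memLp_smear (hT : IsIsotropicGaussianField P T) (ρ : Measure S2) [IsFiniteMeasure ρ]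
    (w : C(S2, ℝ)) : MemLp (fun ω => ∫ z, w z * T z ω ∂ρ) 2 P := by
  have hwm : Measurable fun p : S2 × Ω => w p.1 := w.continuous.measurable.comp measurable_fst
  refine MemLp.integral_prod_left_two (f := fun p : S2 × Ω => w p.1 * T p.1 p.2) ?_
    (hwm.mul hT.measurable).stronglyMeasurable
  refine (hT.memLp_uncurry ρ).of_le_mul (c := ‖w‖)
    (hwm.mul hT.measurable).aestronglyMeasurable (Eventually.of_forall fun p => ?_)
  rw [norm_mul]
  gcongr
  exact w.norm_coe_le_norm _

theorem integrable_mul_uncurry (hT : IsIsotropicGaussianField P T) (ρ : Measure S2)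
    [IsFiniteMeasure ρ] (Z : Lp ℝ 2 P) :
    Integrable (fun p : S2 × Ω => Z p.2 * T p.1 p.2) (ρ.prod P) :=
  MemLp.integrable_mul ((Lp.memLp Z).comp_snd ρ) (hT.memLp_uncurry ρ)

theorem integrable_inner_toL2 (hT : IsIsotropicGaussianField P T) (ρ : Measure S2)
    [IsFiniteMeasure ρ] (Z : Lp ℝ 2 P) : Integrable (fun z => inner ℝ Z (hT.toL2 z)) ρ := by
  simp only [inner_toL2_right]
  exact (hT.integrable_mul_uncurry ρ Z).integral_prod_left

theorem integrable_mul_inner_toL2 (hT : IsIsotropicGaussianField P T) (ρ : Measure S2)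
    [IsFiniteMeasure ρ] (w : C(S2, ℝ)) (Z : Lp ℝ 2 P) :
    Integrable (fun z => w z * inner ℝ Z (hT.toL2 z)) ρ :=
  (hT.integrable_inner_toL2 ρ Z).bdd_mul (c := ‖w‖) w.continuous.aestronglyMeasurable
    (Eventually.of_forall fun z => w.norm_coe_le_norm z)

/-- Fubini: the pathwise average is also the weak `L²`-valued integral. Linearity, boundedness and
membership in the span are all deduced from this formula. -/
theorem inner_toLp_smear (hT : IsIsotropicGaussianField P T) (ρ : Measure S2) [IsFiniteMeasure ρ]
    (w : C(S2, ℝ)) (Z : Lp ℝ 2 P) :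
    inner ℝ Z (hT.memLp_smear ρ w).toLp = ∫ z, w z * inner ℝ Z (hT.toL2 z) ∂ρ := by
  have h1 : inner ℝ Z (hT.memLp_smear ρ w).toLp
      = ∫ ω, ∫ z, w z * (Z ω * T z ω) ∂ρ ∂P := by
    rw [inner_eq_integral]
    refine integral_congr_ae ?_
    filter_upwards [(hT.memLp_smear ρ w).coeFn_toLp] with ω hω
    rw [hω, ← integral_const_mul]
    exact integral_congr_ae (Eventually.of_forall fun z => by ring)
  simp only [h1, hT.inner_toL2_right, ← integral_const_mul]
  have hint' : Integrable (fun p : S2 × Ω => w p.1 * (Z p.2 * T p.1 p.2)) (ρ.prod P) :=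
    (hT.integrable_mul_uncurry ρ Z).bdd_mul (c := ‖w‖) (w.continuous.measurable.comp measurable_fst).aestronglyMeasurable
      (Eventually.of_forall fun p => w.norm_coe_le_norm _)
  exact (integral_integral_swap (f := fun z ω => w z * (Z ω * T z ω)) hint').symm

/-- The smeared field `w ↦ ∫ w(z) T(z) ρ(dz)` with values in `L²`. -/
noncomputable def smear (hT : IsIsotropicGaussianField P T) (ρ : Measure S2) [IsFiniteMeasure ρ] :
    C(S2, ℝ) →L[ℝ] Lp ℝ 2 P :=
  LinearMap.mkContinuous
    { toFun := fun w => (hT.memLp_smear ρ w).toLp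
      map_add' := fun w w' => by
        refine ext_inner_left ℝ fun Z => ?_
        rw [inner_add_right, hT.inner_toLp_smear, hT.inner_toLp_smear, hT.inner_toLp_smear,
          ← integral_add (hT.integrable_mul_inner_toL2 ρ w Z) (hT.integrable_mul_inner_toL2 ρ w' Z)]
        simp only [ContinuousMap.add_apply, add_mul]
      map_smul' := fun c w => by
        refine ext_inner_left ℝ fun Z => ?_
        rw [RingHom.id_apply, inner_smul_right, hT.inner_toLp_smear, hT.inner_toLp_smear,
          ← integral_const_mul]
        simp only [ContinuousMap.smul_apply, smul_eq_mul, mul_assoc] }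
    (‖hT.toL2 northPole‖ * ρ.real Set.univ) (fun w => by
      set U : Lp ℝ 2 P := (hT.memLp_smear ρ w).toLp with hU
      change ‖U‖ ≤ _
      -- The weak formula is tested against `U` itself, after which one factor `‖U‖` is cancelled.
      have h1 : ‖U‖ ^ 2 ≤ ‖w‖ * (‖U‖ * ‖hT.toL2 northPole‖) * ρ.real Set.univ := by
        rw [← real_inner_self_eq_norm_sq]
        nth_rewrite 2 [hU]
        rw [hT.inner_toLp_smear]
        refine (Real.le_norm_self _).trans ?_
        refine norm_integral_le_of_norm_le_const (Eventually.of_forall fun z => ?_)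
        rw [norm_mul]
        gcongr
        · exact w.norm_coe_le_norm z
        · rw [← hT.norm_toL2 z]
          exact norm_inner_le_norm _ _
      rcases (norm_nonneg U).eq_or_lt with h | h
      · rw [← h]; positivity
      · refine le_of_mul_le_mul_left ?_ h
        linarith)

theorem coeFn_smear (hT : IsIsotropicGaussianField P T) (ρ : Measure S2) [IsFiniteMeasure ρ]
    (w : C(S2, ℝ)) : hT.smear ρ w =ᵐ[P] fun ω => ∫ z, w z * T z ω ∂ρ :=
  (hT.memLp_smear ρ w).coeFn_toLp

theorem inner_smear (hT : IsIsotropicGaussianField P T) (ρ : Measure S2) [IsFiniteMeasure ρ]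
    (w : C(S2, ℝ)) (Z : Lp ℝ 2 P) :
    inner ℝ Z (hT.smear ρ w) = ∫ z, w z * inner ℝ Z (hT.toL2 z) ∂ρ :=
  hT.inner_toLp_smear ρ w Z

theorem isCenteredGaussian_of_mem (hT : IsIsotropicGaussianField P T) :
    ∀ Z ∈ hT.space, IsCenteredGaussian Z :=
  isCenteredGaussian_of_mem_closure_span hT.gaussian hT.mean_zero hT.coeFn_toL2

/-- By the weak formula the average is orthogonal to everything orthogonal to the field, so it lies
in the double orthogonal complement. -/
theorem smear_mem_space (hT : IsIsotropicGaussianField P T) (ρ : Measure S2) [IsFiniteMeasure ρ]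
    (w : C(S2, ℝ)) : hT.smear ρ w ∈ hT.space := by
  have hc : IsClosed (hT.space : Set (Lp ℝ 2 P)) := Submodule.isClosed_topologicalClosure _
  have : CompleteSpace hT.space := hc.completeSpace_coe
  rw [← Submodule.orthogonal_orthogonal hT.space, Submodule.mem_orthogonal]
  intro Z hZ
  rw [inner_smear]
  have h : ∀ z, inner ℝ Z (hT.toL2 z) = 0 := fun z =>
    Submodule.inner_left_of_mem_orthogonal (hT.toL2_mem_space z) hZ
  simp [h]

/-- The field smeared over the sphere with a zonal weight centred at `x`. -/
noncomputable def zonalMean (hT : IsIsotropicGaussianField P T) (q : Polynomial ℝ) (x : S2) :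
    Lp ℝ 2 P := hT.smear surface (zonal q x)

theorem continuous_zonalMean (hT : IsIsotropicGaussianField P T) (q : Polynomial ℝ) :
    Continuous (hT.zonalMean q) := (hT.smear surface).continuous.comp (zonal q).continuous

theorem zonalMean_mem_space (hT : IsIsotropicGaussianField P T) (q : Polynomial ℝ) (x : S2) :
    hT.zonalMean q x ∈ hT.space := hT.smear_mem_space _ _

theorem inner_zonalMean (hT : IsIsotropicGaussianField P T) (q : Polynomial ℝ) (x : S2)
    (Z : Lp ℝ 2 P) :
    inner ℝ Z (hT.zonalMean q x) = ∫ z, zonal q x z * inner ℝ Z (hT.toL2 z) ∂surface :=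
  hT.inner_smear _ _ _

theorem inner_toL2_zonalMean_rotate (hT : IsIsotropicGaussianField P T) (q : Polynomial ℝ)
    (g : SO3) (x y : S2) :
    inner ℝ (hT.toL2 (rotate g x)) (hT.zonalMean q (rotate g y))
      = inner ℝ (hT.toL2 x) (hT.zonalMean q y) := by
  rw [inner_zonalMean, inner_zonalMean, ← integral_rotate g]
  simp only [zonal_rotate, inner_toL2_rotate]

theorem inner_zonalMean_rotate (hT : IsIsotropicGaussianField P T) (p q : Polynomial ℝ)
    (g : SO3) (x y : S2) :
    inner ℝ (hT.zonalMean p (rotate g x)) (hT.zonalMean q (rotate g y))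
      = inner ℝ (hT.zonalMean p x) (hT.zonalMean q y) := by
  rw [inner_zonalMean, inner_zonalMean, ← integral_rotate g]
  refine integral_congr_ae (Eventually.of_forall fun z => ?_)
  simp only [zonal_rotate]
  rw [real_inner_comm, inner_toL2_zonalMean_rotate, real_inner_comm]

/-- Invariance under the rotation that exchanges `x` and `y`. -/
theorem inner_toL2_zonalMean_swap (hT : IsIsotropicGaussianField P T) (q : Polynomial ℝ)
    (x y : S2) :
    inner ℝ (hT.toL2 x) (hT.zonalMean q y) = inner ℝ (hT.toL2 y) (hT.zonalMean q x) := by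
  obtain ⟨g, hx, hy⟩ := exists_rotate_swap x y
  rw [← hT.inner_toL2_zonalMean_rotate q g x y, hx, hy]

theorem norm_zonalMean (hT : IsIsotropicGaussianField P T) (q : Polynomial ℝ) (x : S2) :
    ‖hT.zonalMean q x‖ = ‖hT.zonalMean q northPole‖ := by
  obtain ⟨g, hg, -⟩ := exists_rotate_swap northPole x
  have h := hT.inner_zonalMean_rotate q q g northPole northPole
  rw [hg, real_inner_self_eq_norm_sq, real_inner_self_eq_norm_sq] at h
  exact (sq_eq_sq₀ (norm_nonneg _) (norm_nonneg _)).1 h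

/-- This carries approximation at the pole to every other point with the same error. -/
theorem norm_toL2_sub_zonalMean (hT : IsIsotropicGaussianField P T) (q : Polynomial ℝ) (x : S2) :
    ‖hT.toL2 x - hT.zonalMean q x‖ = ‖hT.toL2 northPole - hT.zonalMean q northPole‖ := by
  obtain ⟨g, hg, -⟩ := exists_rotate_swap northPole x
  have h := hT.inner_toL2_zonalMean_rotate q g northPole northPole
  rw [hg] at h
  rw [← sq_eq_sq₀ (norm_nonneg _) (norm_nonneg _), norm_sub_sq_real, norm_sub_sq_real, h,
    hT.norm_toL2 x, hT.norm_zonalMean q x]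

theorem zonalMean_C_mul (hT : IsIsotropicGaussianField P T) (c : ℝ) (q : Polynomial ℝ) (x : S2) :
    hT.zonalMean (Polynomial.C c * q) x = c • hT.zonalMean q x := by
  rw [zonalMean, zonalMean, ← map_smul]
  congr 1
  ext z
  simp [zonal_apply]

theorem zonalMean_sum (hT : IsIsotropicGaussianField P T) {ι : Type*} (s : Finset ι)
    (q : ι → Polynomial ℝ) (x : S2) :
    hT.zonalMean (∑ i ∈ s, q i) x = ∑ i ∈ s, hT.zonalMean (q i) x := by
  simp only [zonalMean, ← map_sum]
  congr 1
  ext z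
  simp [zonal_apply, Polynomial.eval_finsetSum, ContinuousMap.sum_apply]

end IsIsotropicGaussianField

end Field

/-! ### Spherical harmonics at the north pole. -/

open GaussianHilbert

theorem inner_northPole (z : S2) : inner ℝ (northPole : E3) (z : E3) = (z : E3) 2 := by
  simp [northPole, EuclideanSpace.inner_single_left]

theorem sphericalHarmonicNonneg_zero (l : ℕ) (z : S2) :
    sphericalHarmonicNonneg l 0 z
      = ((Real.sqrt ((2 * (l : ℝ) + 1) / (4 * Real.pi)) * zonal (legendre l) northPole z : ℝ) : ℂ) := by
  have hf : ((l.factorial : ℕ) : ℝ) ≠ 0 := by exact_mod_cast l.factorial_ne_zero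
  rw [zonal_apply, inner_northPole]
  simp [sphericalHarmonicNonneg, assocLegendre, div_self hf]

theorem sphericalHarmonic_zero (l : ℕ) (z : S2) :
    sphericalHarmonic l 0 z
      = ((Real.sqrt ((2 * (l : ℝ) + 1) / (4 * Real.pi)) * zonal (legendre l) northPole z : ℝ) : ℂ) := by
  rw [← sphericalHarmonicNonneg_zero]
  simp [sphericalHarmonic]

/-- The factor `(1 - z²)^{|m|/2}` vanishes at `z = 1`. -/
theorem sphericalHarmonic_northPole_of_ne (l : ℕ) {m : ℤ} (hm : m ≠ 0) :
    sphericalHarmonic l m northPole = 0 := by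
  have h : sphericalHarmonicNonneg l m.natAbs northPole = 0 := by
    simp [sphericalHarmonicNonneg, assocLegendre, northPole, hm]
  simp [sphericalHarmonic, h]

theorem sphericalHarmonic_zero_northPole (l : ℕ) :
    sphericalHarmonic l 0 northPole = ((Real.sqrt ((2 * (l : ℝ) + 1) / (4 * Real.pi)) : ℝ) : ℂ) := by
  rw [sphericalHarmonic_zero, zonal_apply, inner_northPole]
  simp [northPole, legendre_eval_one]

theorem harmonicCoeff_zero {Ω : Type*} (T : S2 → Ω → ℝ) (l : ℕ) (ω : Ω) :
    harmonicCoeff T l 0 ω = ((Real.sqrt ((2 * (l : ℝ) + 1) / (4 * Real.pi))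
      * ∫ z, zonal (legendre l) northPole z * T z ω ∂surface : ℝ) : ℂ) := by
  rw [harmonicCoeff, ← integral_const_mul, ← integral_complex_ofReal]
  refine integral_congr_ae (Eventually.of_forall fun z => ?_)
  simp only [sphericalHarmonic_zero, Complex.conj_ofReal]
  push_cast
  ring

/-! ### Decomposition of the field into orthogonal components by degree. -/

section Field

variable {Ω : Type*} [mΩ : MeasurableSpace Ω] {P : Measure Ω} {T : S2 → Ω → ℝ}

namespace IsIsotropicGaussianField

variable [IsProbabilityMeasure P]

/-- The projection of the field at `x` onto the harmonics of degree `l`. -/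
noncomputable def component (hT : IsIsotropicGaussianField P T) (l : ℕ) (x : S2) : Lp ℝ 2 P :=
  ((2 * (l : ℝ) + 1) / (4 * Real.pi)) • hT.zonalMean (legendre l) x

theorem sum_smul_component (hT : IsIsotropicGaussianField P T) (c : ℕ → ℝ) (s : Finset ℕ)
    (x : S2) :
    ∑ l ∈ s, c l • hT.component l x = hT.zonalMean (∑ l ∈ s,
      Polynomial.C (c l) * (Polynomial.C ((2 * (l : ℝ) + 1) / (4 * Real.pi)) * legendre l)) x := by
  simp only [zonalMean_sum, zonalMean_C_mul, component]

theorem component_mem_space (hT : IsIsotropicGaussianField P T) (l : ℕ) (x : S2) :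
    hT.component l x ∈ hT.space :=
  hT.space.smul_mem _ (hT.zonalMean_mem_space _ _)

/-- One square root of `(2l+1)/(4π)` is the normalisation of `Y_{l0}` inside `a_{l0}`, the other its
value at the pole. -/
theorem component_northPole (hT : IsIsotropicGaussianField P T) (l : ℕ) :
    ∀ᵐ ω ∂P, (hT.component l northPole ω : ℂ)
      = (Real.sqrt ((2 * (l : ℝ) + 1) / (4 * Real.pi)) : ℂ) * harmonicCoeff T l 0 ω := by
  filter_upwards [Lp.coeFn_smul ((2 * (l : ℝ) + 1) / (4 * Real.pi))
    (hT.zonalMean (legendre l) northPole),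
    hT.coeFn_smear surface (zonal (legendre l) northPole)] with ω h1 h2
  rw [component, h1, Pi.smul_apply, zonalMean, h2, harmonicCoeff_zero, smul_eq_mul,
    ← Complex.ofReal_mul, ← mul_assoc, Real.mul_self_sqrt (by positivity)]

theorem spectralSum_northPole (hT : IsIsotropicGaussianField P T) (L : ℕ) :
    ∀ᵐ ω ∂P, spectralSum T L northPole ω
      = ((∑ l ∈ Finset.range (L + 1), hT.component l northPole : Lp ℝ 2 P) ω : ℂ) := by
  have h1 : ∀ᵐ ω ∂P, ∀ l, (hT.component l northPole ω : ℂ)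
      = (Real.sqrt ((2 * (l : ℝ) + 1) / (4 * Real.pi)) : ℂ) * harmonicCoeff T l 0 ω :=
    ae_all_iff.2 hT.component_northPole
  filter_upwards [h1, Lp.coeFn_finsetSum (s := Finset.range (L + 1))
    (f := fun l => hT.component l northPole)] with ω h1 h2
  rw [h2, Finset.sum_apply, Complex.ofReal_sum, spectralSum]
  refine Finset.sum_congr rfl fun l _ => ?_
  rw [Finset.sum_eq_single 0, h1, sphericalHarmonic_zero_northPole, mul_comm]
  · intro m _ hm
    rw [sphericalHarmonic_northPole_of_ne l hm, mul_zero]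
  · intro h
    exact absurd (Finset.mem_Icc.2 ⟨by simp, by simp⟩) h

theorem norm_toL2_sub_sum_component (hT : IsIsotropicGaussianField P T) (s : Finset ℕ) (x : S2) :
    ‖hT.toL2 x - ∑ l ∈ s, hT.component l x‖
      = ‖hT.toL2 northPole - ∑ l ∈ s, hT.component l northPole‖ := by
  have h := fun y => hT.sum_smul_component (fun _ => 1) s y
  simp only [one_smul] at h
  rw [h, h, norm_toL2_sub_zonalMean]

theorem tendsto_norm_toL2_sub_sum_component (hT : IsIsotropicGaussianField P T) :
    Tendsto (fun L => ‖hT.toL2 northPole - ∑ l ∈ Finset.range L, hT.component l northPole‖)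
      atTop (𝓝 0) := by
  -- The spectral sum of order `L` contains the degrees up to and including `L`, that is `range (L +
  -- 1)`.
  rw [← tendsto_add_atTop_iff_nat 1]
  have h := hT.spectral northPole
  have h2 := (ENNReal.tendsto_toReal ENNReal.zero_ne_top).comp h
  refine h2.congr fun L => ?_
  rw [Function.comp_apply, Lp.norm_def]
  congr 1
  refine eLpNorm_congr_norm_ae ?_
  filter_upwards [hT.spectralSum_northPole L, hT.coeFn_toL2 northPole,
    Lp.coeFn_sub (hT.toL2 northPole)
      (∑ l ∈ Finset.range (L + 1), hT.component l northPole)] with ω h1 h2 h3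
  rw [h1, h3, Pi.sub_apply, h2, ← Complex.ofReal_sub, Complex.norm_real]

theorem tendsto_sum_component (hT : IsIsotropicGaussianField P T) (x : S2) :
    Tendsto (fun L => ∑ l ∈ Finset.range L, hT.component l x) atTop (𝓝 (hT.toL2 x)) := by
  rw [tendsto_iff_norm_sub_tendsto_zero]
  refine hT.tendsto_norm_toL2_sub_sum_component.congr fun L => ?_
  rw [← hT.norm_toL2_sub_sum_component _ x, norm_sub_rev]

/-- The error of the partial sums is the same at all points, so continuous functions converge
uniformly. -/
theorem continuous_toL2 (hT : IsIsotropicGaussianField P T) : Continuous hT.toL2 := by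
  have hu : TendstoUniformly (fun L x => ∑ l ∈ Finset.range L, hT.component l x) hT.toL2 atTop := by
    rw [Metric.tendstoUniformly_iff]
    intro ε hε
    filter_upwards [hT.tendsto_norm_toL2_sub_sum_component.eventually (gt_mem_nhds hε)] with L hL x
    rwa [dist_eq_norm, hT.norm_toL2_sub_sum_component]
  refine hu.continuous (Frequently.of_forall fun L => ?_)
  exact continuous_finsetSum _ fun l _ => (hT.continuous_zonalMean (legendre l)).const_smul
    ((2 * (l : ℝ) + 1) / (4 * Real.pi))

/-- After the exchange symmetry moves the kernel onto `z`, the covariance is a double integral with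
inner factor `∫ Q_m(⟨y,z⟩) Q_l(⟨z,z'⟩) dz`, which is zero. Continuity of the field in `L²` justifies
Fubini. -/
theorem inner_zonalMean_legendre (hT : IsIsotropicGaussianField P T) {l m : ℕ} (hlm : l ≠ m)
    (x y : S2) :
    inner ℝ (hT.zonalMean (legendre l) x) (hT.zonalMean (legendre m) y) = 0 := by
  rw [inner_zonalMean]
  have h1 : ∀ z, inner ℝ (hT.zonalMean (legendre l) x) (hT.toL2 z)
      = ∫ z', zonal (legendre l) z z' * inner ℝ (hT.toL2 x) (hT.toL2 z') ∂surface := by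
    intro z
    rw [real_inner_comm, inner_toL2_zonalMean_swap, inner_zonalMean]
  have hc := hT.continuous_toL2
  have hcont : Continuous (Function.uncurry fun z z' : S2 => zonal (legendre m) y z
      * (zonal (legendre l) z z' * inner ℝ (hT.toL2 x) (hT.toL2 z'))) := by
    have c1 : Continuous fun p : S2 × S2 => zonal (legendre l) p.1 p.2 :=
      (legendre l).continuous.comp (by fun_prop)
    have c2 : Continuous fun p : S2 × S2 => zonal (legendre m) y p.1 :=
      (zonal (legendre m) y).continuous.comp continuous_fst
    have c3 : Continuous fun p : S2 × S2 => inner ℝ (hT.toL2 x) (hT.toL2 p.2) :=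
      continuous_const.inner (hc.comp continuous_snd)
    exact c2.mul (c1.mul c3)
  simp only [h1, ← integral_const_mul]
  rw [integral_integral_swap_of_hasCompactSupport hcont (HasCompactSupport.of_compactSpace _)]
  have h2 : ∀ z' : S2, ∫ z, zonal (legendre m) y z
      * (zonal (legendre l) z z' * inner ℝ (hT.toL2 x) (hT.toL2 z')) ∂surface = 0 := by
    intro z'
    simp only [← mul_assoc]
    rw [integral_mul_const]
    simp only [zonal_comm (legendre l) _ z', zonal_apply]
    rw [integral_legendre_mul_legendre (Ne.symm hlm), zero_mul]
  simp [h2]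

theorem inner_component_of_ne (hT : IsIsotropicGaussianField P T) {l m : ℕ} (hlm : l ≠ m)
    (x y : S2) : inner ℝ (hT.component l x) (hT.component m y) = 0 := by
  rw [component, component, inner_smul_left, inner_smul_right,
    hT.inner_zonalMean_legendre hlm, mul_zero, mul_zero]

/-- Such a combination is the zonal mean of a single polynomial, whose norm does not depend on its
centre. -/
theorem norm_sum_smul_component (hT : IsIsotropicGaussianField P T) (c : ℕ → ℝ) (s : Finset ℕ)
    (x : S2) : ‖∑ l ∈ s, c l • hT.component l x‖
      = ‖∑ l ∈ s, c l • hT.component l northPole‖ := by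
  rw [sum_smul_component, sum_smul_component, norm_zonalMean]

end IsIsotropicGaussianField

end Field

/-! ### Bounded multipliers of orthogonal series -/

section Orthogonal

variable {E : Type*} [NormedAddCommGroup E] [InnerProductSpace ℝ E] {u : ℕ → E}

theorem norm_sq_sum_of_orthogonal (hu : ∀ l m, l ≠ m → inner ℝ (u l) (u m) = 0) (c : ℕ → ℝ)
    (s : Finset ℕ) : ‖∑ l ∈ s, c l • u l‖ ^ 2 = ∑ l ∈ s, c l ^ 2 * ‖u l‖ ^ 2 := by
  rw [← real_inner_self_eq_norm_sq, sum_inner]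
  refine Finset.sum_congr rfl fun l hl => ?_
  rw [inner_sum, Finset.sum_eq_single l]
  · rw [inner_smul_left, inner_smul_right, real_inner_self_eq_norm_sq]
    simp
    ring
  · intro m _ hm
    rw [inner_smul_left, inner_smul_right, hu l m hm.symm, mul_zero, mul_zero]
  · exact fun h => absurd hl h

theorem norm_sum_smul_le_of_orthogonal (hu : ∀ l m, l ≠ m → inner ℝ (u l) (u m) = 0) {c : ℕ → ℝ}
    (hc : ∀ l, |c l| ≤ 1) (s : Finset ℕ) : ‖∑ l ∈ s, c l • u l‖ ≤ ‖∑ l ∈ s, u l‖ := by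
  have h := norm_sq_sum_of_orthogonal hu (fun _ => 1) s
  simp only [one_smul, one_pow, one_mul] at h
  rw [← sq_le_sq₀ (norm_nonneg _) (norm_nonneg _), h, norm_sq_sum_of_orthogonal hu]
  refine Finset.sum_le_sum fun l _ => ?_
  have : c l ^ 2 ≤ 1 := (sq_le_one_iff_abs_le_one _).2 (hc l)
  exact mul_le_of_le_one_left (by positivity) this

theorem cauchySeq_sum_smul_of_orthogonal (hu : ∀ l m, l ≠ m → inner ℝ (u l) (u m) = 0)
    {c : ℕ → ℝ} (hc : ∀ l, |c l| ≤ 1)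
    (h : CauchySeq fun L => ∑ l ∈ Finset.range L, u l) :
    CauchySeq fun L => ∑ l ∈ Finset.range L, c l • u l := by
  have key : ∀ m n, m ≤ n → dist (∑ l ∈ Finset.range m, c l • u l)
      (∑ l ∈ Finset.range n, c l • u l)
      ≤ dist (∑ l ∈ Finset.range m, u l) (∑ l ∈ Finset.range n, u l) := by
    intro m n hmn
    rw [dist_comm, dist_comm (∑ l ∈ Finset.range m, u l), dist_eq_norm, dist_eq_norm,
      ← Finset.sum_Ico_eq_sub _ hmn, ← Finset.sum_Ico_eq_sub _ hmn]
    exact norm_sum_smul_le_of_orthogonal hu hc _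
  rw [Metric.cauchySeq_iff] at h ⊢
  intro ε hε
  obtain ⟨N, hN⟩ := h ε hε
  refine ⟨N, fun m hm n hn => ?_⟩
  rcases le_total m n with hmn | hmn
  · exact (key m n hmn).trans_lt (hN m hm n hn)
  · rw [dist_comm]
    exact (key n m hmn).trans_lt (hN n hn m hm)

end Orthogonal

end SphereField

/-! ### Freezing an independent random argument. -/

/-- In the applications `W` is the identity of `Ω` into a smaller `σ`-field; the formula then
replaces `V` by an independent copy while `ω` is kept. -/
theorem ProbabilityTheory.IndepFun.map_prodMk_eq_map_prod {Ω S Ω' : Type*} [MeasurableSpace Ω]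
    [MeasurableSpace S] [MeasurableSpace Ω'] {P : Measure Ω} [IsProbabilityMeasure P] {V : Ω → S}
    {W : Ω → Ω'} (h : IndepFun V W P) (hV : Measurable V) (hW : Measurable W) :
    P.map (fun ω => (V ω, W ω)) = ((P.map V).prod P).map (Prod.map id W) := by
  have : IsProbabilityMeasure (P.map V) := Measure.isProbabilityMeasure_map hV.aemeasurable
  rw [(indepFun_iff_map_prod_eq_prod_map_map hV.aemeasurable hW.aemeasurable).1 h,
    ← Measure.map_prod_map _ _ measurable_id hW, Measure.map_id]

theorem ProbabilityTheory.IndepFun.integrable_comp_iff {Ω S Ω' : Type*} [MeasurableSpace Ω]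
    [MeasurableSpace S] [MeasurableSpace Ω'] {P : Measure Ω} [IsProbabilityMeasure P] {V : Ω → S}
    {W : Ω → Ω'} (h : IndepFun V W P) (hV : Measurable V) (hW : Measurable W) {F : S × Ω' → ℝ}
    (hF : Measurable F) : Integrable (fun ω => F (V ω, W ω)) P ↔
      Integrable (fun p : S × Ω => F (p.1, W p.2)) ((P.map V).prod P) := by
  have h1 := integrable_map_measure (μ := P) (f := fun ω => (V ω, W ω)) (g := F)
    hF.aestronglyMeasurable (hV.prodMk hW).aemeasurable
  have h2 := integrable_map_measure (μ := (P.map V).prod P) (f := Prod.map id W) (g := F)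
    hF.aestronglyMeasurable (measurable_id.prodMap hW).aemeasurable
  rw [h.map_prodMk_eq_map_prod hV hW] at h1
  exact h1.symm.trans h2

theorem ProbabilityTheory.IndepFun.integral_comp {Ω S Ω' : Type*} [MeasurableSpace Ω]
    [MeasurableSpace S] [MeasurableSpace Ω'] {P : Measure Ω} [IsProbabilityMeasure P] {V : Ω → S}
    {W : Ω → Ω'} (h : IndepFun V W P) (hV : Measurable V) (hW : Measurable W) {F : S × Ω' → ℝ}
    (hF : Measurable F) : ∫ ω, F (V ω, W ω) ∂P
      = ∫ p : S × Ω, F (p.1, W p.2) ∂((P.map V).prod P) := by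
  have h1 := integral_map (μ := P) (φ := fun ω => (V ω, W ω)) (f := F)
    (hV.prodMk hW).aemeasurable hF.aestronglyMeasurable
  have h2 := integral_map (μ := (P.map V).prod P) (φ := Prod.map id W) (f := F)
    (measurable_id.prodMap hW).aemeasurable hF.aestronglyMeasurable
  rw [h.map_prodMk_eq_map_prod hV hW] at h1
  exact h1.symm.trans h2

/-! ### Heat kernel, Brownian motion and subordinator. -/

namespace SphereField

open GaussianHilbert

theorem measurable_uncurry_process {Ω : Type*} [MeasurableSpace Ω] {B : ℝ≥0 → Ω → S2}
    (hc : ∀ ω, Continuous fun t => B t ω) (hB : ∀ t, Measurable (B t)) :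
    Measurable fun p : ℝ≥0 × Ω => B p.1 p.2 :=
  measurable_uncurry_of_continuous_of_measurable (u := B) hc hB

theorem measurable_subordinate {Ω : Type*} [MeasurableSpace Ω] {B : ℝ≥0 → Ω → S2}
    {D : ℝ≥0 → Ω → ℝ≥0} (hc : ∀ ω, Continuous fun t => B t ω) (hB : ∀ t, Measurable (B t))
    (hD : ∀ t, Measurable (D t)) (t : ℝ≥0) : Measurable (subordinate B D t) :=
  (measurable_uncurry_process hc hB).comp
    ((hD t).prodMk measurable_id)

theorem measurable_processSigma {Ω E : Type*} [MeasurableSpace E] (X : ℝ≥0 → Ω → E) (t : ℝ≥0) :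
    Measurable[processSigma X] (X t) :=
  Measurable.mono (comap_measurable (X t)) (le_iSup (fun t => MeasurableSpace.comap (X t) _) t)
    le_rfl

theorem summable_heat_bound {s : ℝ} (hs : 0 < s) :
    Summable fun l : ℕ => (2 * (l : ℝ) + 1) / (4 * Real.pi) * 4 ^ l * Real.exp (-s * eigen l) := by
  -- The constant is `12 = 3 · 4`, from `2l + 1 ≤ 3^l` and the bound `4^l` on `Q_l`. Since `e^{-s
  -- l(l+1)}` is the `l`-th power of `e^{-s(l+1)}`, the terms are eventually below `2^{-l}`.
  have ht : Tendsto (fun l : ℕ => 12 * Real.exp (-s * (l + 1))) atTop (𝓝 (12 * 0)) := by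
    refine Tendsto.const_mul _ (Real.tendsto_exp_atBot.comp ?_)
    refine Tendsto.const_mul_atTop_of_neg (by linarith) ?_
    exact tendsto_atTop_add_const_right _ _ tendsto_natCast_atTop_atTop
  have hev : ∀ᶠ l : ℕ in atTop, 12 * Real.exp (-s * (l + 1)) < 1 / 2 :=
    ht.eventually (gt_mem_nhds (by norm_num))
  refine Summable.of_norm_bounded_eventually_nat (g := fun l => (1 / 2 : ℝ) ^ l)
    summable_geometric_two ?_
  filter_upwards [hev] with l hl
  rw [Real.norm_of_nonneg (by positivity)]
  have h1 : (2 * (l : ℝ) + 1) / (4 * Real.pi) ≤ 3 ^ l := by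
    have hb : 1 + (l : ℝ) * 2 ≤ (1 + 2) ^ l := one_add_mul_le_pow (by norm_num) l
    have hpi : 1 ≤ 4 * Real.pi := by nlinarith [Real.pi_gt_three]
    calc (2 * (l : ℝ) + 1) / (4 * Real.pi) ≤ 2 * (l : ℝ) + 1 := div_le_self (by positivity) hpi
      _ ≤ 3 ^ l := by norm_num at hb; linarith
  have h2 : Real.exp (-s * eigen l) = Real.exp (-s * (l + 1)) ^ l := by
    rw [← Real.exp_nat_mul, eigen]; congr 1; ring
  calc (2 * (l : ℝ) + 1) / (4 * Real.pi) * 4 ^ l * Real.exp (-s * eigen l)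
      ≤ 3 ^ l * 4 ^ l * Real.exp (-s * (l + 1)) ^ l := by rw [h2]; gcongr
    _ = (12 * Real.exp (-s * (l + 1))) ^ l := by rw [← mul_pow, ← mul_pow]; norm_num
    _ ≤ (1 / 2) ^ l := by gcongr

theorem hasSum_integral_heatKernel {s : ℝ} (hs : 0 < s) (x : S2) (f : C(S2, ℝ)) :
    HasSum (fun l : ℕ => Real.exp (-s * eigen l) * ((2 * (l : ℝ) + 1) / (4 * Real.pi)
      * ∫ y, zonal (legendre l) x y * f y ∂surface)) (∫ y, heatKernel s x y * f y ∂surface) := by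
  set F : ℕ → S2 → ℝ := fun l y => (2 * (l : ℝ) + 1) / (4 * Real.pi)
    * (legendre l).eval (inner ℝ (x : E3) (y : E3)) * Real.exp (-s * eigen l) * f y with hF
  have hcont : ∀ l, Continuous (F l) := fun l => by
    have := continuous_zonal (legendre l) x
    fun_prop
  have hbound : ∀ l y, ‖F l y‖
      ≤ (2 * (l : ℝ) + 1) / (4 * Real.pi) * 4 ^ l * Real.exp (-s * eigen l) * ‖f‖ := by
    intro l y
    simp only [hF, norm_mul]
    rw [Real.norm_of_nonneg (show 0 ≤ (2 * (l : ℝ) + 1) / (4 * Real.pi) by positivity),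
      Real.norm_of_nonneg (Real.exp_nonneg _), Real.norm_eq_abs]
    gcongr
    · exact abs_legendre_eval_le l (inner_mem_Icc x y)
    · exact f.norm_coe_le_norm y
  have hsum := (summable_heat_bound hs).mul_right ‖f‖
  have h := hasSum_integral_of_summable_integral_norm (μ := surface) (F := F)
    (fun l => integrable_surface_of_continuous (hcont l)) (by
      refine Summable.of_nonneg_of_le (fun l => integral_nonneg fun y => norm_nonneg _)
        (fun l => ?_) (hsum.mul_right (surface.real Set.univ))
      calc ∫ y, ‖F l y‖ ∂surface ≤ ∫ y : S2, (2 * (l : ℝ) + 1) / (4 * Real.pi) * 4 ^ l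
            * Real.exp (-s * eigen l) * ‖f‖ ∂surface :=
            integral_mono (integrable_surface_of_continuous (hcont l)).norm
              (integrable_const _) (hbound l)
        _ = _ := by rw [integral_const, smul_eq_mul, mul_comm])
  have e : ∀ y, ∑' l, F l y = heatKernel s x y * f y := by
    intro y
    rw [heatKernel, ← tsum_mul_right]
  simp only [e] at h
  have e2 : ∀ l : ℕ, Real.exp (-s * eigen l) * ((2 * (l : ℝ) + 1) / (4 * Real.pi)
      * ∫ y, zonal (legendre l) x y * f y ∂surface) = ∫ y, F l y ∂surface := by
    intro l
    rw [← integral_const_mul, ← integral_const_mul]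
    refine integral_congr_ae (Eventually.of_forall fun y => ?_)
    simp only [hF, zonal_apply]
    ring
  simpa only [e2] using h

section Motion

variable {Ω : Type*} [mΩ : MeasurableSpace Ω] {P : Measure Ω} [IsProbabilityMeasure P]

theorem IsSphericalBrownian.integral_comp {x : S2} {B : ℝ≥0 → Ω → S2}
    (hB : IsSphericalBrownian P x B) {s : ℝ≥0} (hs : 0 < s) (f : C(S2, ℝ)) :
    ∫ ω, f (B s ω) ∂P = ∫ y, heatKernel s x y * f y ∂surface := by
  have hm : (⨆ u : Set.Iic (0 : ℝ≥0), MeasurableSpace.comap (B u) inferInstance) ≤ mΩ :=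
    iSup_le fun u => (hB.measurable u).comap_le
  have h := hB.markov 0 s hs f
  rw [zero_add] at h
  rw [← integral_condExp hm (f := fun ω => f (B s ω)), integral_congr_ae h]
  simp [hB.zero]

theorem IsSubordinator.integral_exp_eigen {b : ℝ≥0} {M : Measure ℝ} {D : ℝ≥0 → Ω → ℝ≥0}
    (hD : IsSubordinator P (laplaceExponent b M) D) (t : ℝ≥0) (l : ℕ) :
    ∫ ω, Real.exp (-(D t ω : ℝ) * eigen l) ∂P
      = Real.exp (-(t : ℝ) * laplaceExponent b M (eigen l)) := by
  -- The Laplace transform is prescribed for `μ > 0` only; at `μ = 0` both sides equal one because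
  -- `Ψ(0) = 0`.
  rcases (eigen_nonneg l).eq_or_lt with h | h
  · simp [← h, laplaceExponent]
  · rw [← hD.laplace t _ h]
    refine integral_congr_ae (Eventually.of_forall fun ω => ?_)
    simp only
    congr 1
    ring

/-- The number is the expectation of a variable with values in `[0, 1]`, so the sign of `Ψ` need not
be examined. -/
theorem IsSubordinator.abs_exp_laplaceExponent_le {b : ℝ≥0} {M : Measure ℝ} {D : ℝ≥0 → Ω → ℝ≥0}
    (hD : IsSubordinator P (laplaceExponent b M) D) (t : ℝ≥0) (l : ℕ) :
    |Real.exp (-(t : ℝ) * laplaceExponent b M (eigen l))| ≤ 1 := by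
  rw [← hD.integral_exp_eigen t l]
  have h := norm_integral_le_of_norm_le_const (μ := P) (C := 1)
    (f := fun ω => Real.exp (-(D t ω : ℝ) * eigen l)) (Eventually.of_forall fun ω => by
      rw [Real.norm_of_nonneg (Real.exp_nonneg _)]
      refine Real.exp_le_one_iff.2 ?_
      have := mul_nonneg (D t ω).coe_nonneg (eigen_nonneg l)
      linarith)
  rwa [probReal_univ, mul_one] at h

theorem integral_subordinate {B : ℝ≥0 → Ω → S2} {D : ℝ≥0 → Ω → ℝ≥0}
    (hB : ∀ t, Measurable (B t)) (hc : ∀ ω, Continuous fun t => B t ω)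
    (hD : ∀ t, Measurable (D t)) (hBD : Indep (processSigma B) (processSigma D) P) (t : ℝ≥0)
    (f : C(S2, ℝ)) :
    ∫ ω, f (subordinate B D t ω) ∂P = ∫ ω, ∫ ω', f (B (D t ω) ω') ∂P ∂P := by
  have hle : processSigma B ≤ mΩ := iSup_le fun u => (hB u).comap_le
  have hind : @IndepFun Ω ℝ≥0 Ω mΩ inferInstance (processSigma B) (D t) id P := by
    refine (@IndepFun_iff_Indep Ω ℝ≥0 Ω mΩ _ (processSigma B) (D t) id P).2 ?_
    rw [MeasurableSpace.comap_id]
    exact indep_of_indep_of_le_left hBD.symm (measurable_processSigma D t).comap_le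
  -- Path continuity makes `B` jointly measurable already for the `σ`-field it generates, the one
  -- independent of `D`.
  have hF : @Measurable (ℝ≥0 × Ω) ℝ (@Prod.instMeasurableSpace _ _ _ (processSigma B)) _
      (fun p : ℝ≥0 × Ω => f (B p.1 p.2)) :=
    f.continuous.measurable.comp
      (@measurable_uncurry_process Ω (processSigma B) B hc (measurable_processSigma B))
  have h := @ProbabilityTheory.IndepFun.integral_comp Ω ℝ≥0 Ω mΩ _ (processSigma B) P _ (D t) id
    hind (hD t) (measurable_id'' hle) _ hF
  have hm : Measurable fun p : ℝ≥0 × Ω => f (B p.1 p.2) :=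
    f.continuous.measurable.comp (measurable_uncurry_process hc hB)
  have : IsProbabilityMeasure (P.map (D t)) :=
    Measure.isProbabilityMeasure_map (hD t).aemeasurable
  have hint : Integrable (fun p : ℝ≥0 × Ω => f (B p.1 p.2)) ((P.map (D t)).prod P) :=
    Integrable.of_bound hm.aestronglyMeasurable ‖f‖
      (Eventually.of_forall fun p => f.norm_coe_le_norm _)
  simp only [id] at h
  rw [integral_prod _ hint] at h
  rw [integral_map (hD t).aemeasurable
    hm.stronglyMeasurable.integral_prod_right'.aestronglyMeasurable] at h
  exact h

end Motion

/-! ### The average of the field over the law of the subordinate motion. -/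

open GaussianHilbert

namespace IsIsotropicGaussianField

variable {Ω : Type*} [mΩ : MeasurableSpace Ω] {P : Measure Ω} [IsProbabilityMeasure P]
  {T : S2 → Ω → ℝ}

/-- The covariance of the field with a fixed element of `L²`, as a continuous function. -/
noncomputable def cov (hT : IsIsotropicGaussianField P T) (Z : Lp ℝ 2 P) : C(S2, ℝ) :=
  ⟨fun z => inner ℝ Z (hT.toL2 z), continuous_const.inner hT.continuous_toL2⟩

theorem cov_apply (hT : IsIsotropicGaussianField P T) (Z : Lp ℝ 2 P) (z : S2) :
    hT.cov Z z = inner ℝ Z (hT.toL2 z) := rfl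

/-- For `s > 0` this is the expansion of the heat kernel. At `s = 0` it is the spectral
decomposition of `T(x)`; this case cannot be dropped, since `D_t` may be zero. -/
theorem tendsto_integral_cov_brownian (hT : IsIsotropicGaussianField P T) (Z : Lp ℝ 2 P) {x : S2}
    {B : ℝ≥0 → Ω → S2} (hB : IsSphericalBrownian P x B) (s : ℝ≥0) :
    Tendsto (fun L => ∑ l ∈ Finset.range L, Real.exp (-(s : ℝ) * eigen l)
      * inner ℝ Z (hT.component l x)) atTop (𝓝 (∫ ω, hT.cov Z (B s ω) ∂P)) := by
  rcases eq_zero_or_pos s with rfl | hs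
  · have h := (continuous_const.inner continuous_id : Continuous fun W : Lp ℝ 2 P =>
      inner ℝ Z W).continuousAt.tendsto.comp (hT.tendsto_sum_component x)
    simp only [hB.zero, integral_const, probReal_univ, one_smul, cov_apply]
    refine h.congr fun L => ?_
    simp [inner_sum]
  · rw [hB.integral_comp hs]
    refine (hasSum_integral_heatKernel (NNReal.coe_pos.2 hs) x (hT.cov Z)).tendsto_sum_nat.congr
      fun L => Finset.sum_congr rfl fun l _ => ?_
    rw [component, inner_smul_right, inner_zonalMean]
    rfl

/-- By orthogonality, multipliers bounded by one do not increase the norms of the partial sums,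
which are bounded. The constant is uniform in the multipliers and so dominates the random ones
`e^{-D_t μ_l}`. -/
theorem abs_sum_exp_inner_component_le (hT : IsIsotropicGaussianField P T) (x : S2) :
    ∃ C, ∀ (Z : Lp ℝ 2 P) (L : ℕ) (c : ℕ → ℝ), (∀ l, |c l| ≤ 1) →
      |∑ l ∈ Finset.range L, c l * inner ℝ Z (hT.component l x)| ≤ ‖Z‖ * C := by
  obtain ⟨C, hC⟩ := (hT.tendsto_sum_component x).norm.bddAbove_range
  refine ⟨C, fun Z L c hc => ?_⟩
  have h : ∑ l ∈ Finset.range L, c l * inner ℝ Z (hT.component l x)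
      = inner ℝ Z (∑ l ∈ Finset.range L, c l • hT.component l x) := by
    simp only [inner_sum, inner_smul_right]
  rw [h]
  refine (abs_real_inner_le_norm _ _).trans ?_
  gcongr
  exact (norm_sum_smul_le_of_orthogonal (fun l m hlm => hT.inner_component_of_ne hlm x x) hc _).trans
    (hC ⟨L, rfl⟩)

/-- The Brownian expansion is taken at the frozen time `D_t` and integrated by dominated
convergence, which replaces `e^{-D_t μ_l}` by its expectation. -/
theorem tendsto_integral_cov_subordinate (hT : IsIsotropicGaussianField P T) (Z : Lp ℝ 2 P)
    {x : S2} {B : ℝ≥0 → Ω → S2} (hB : IsSphericalBrownian P x B) {b : ℝ≥0} {M : Measure ℝ}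
    {D : ℝ≥0 → Ω → ℝ≥0} (hD : IsSubordinator P (laplaceExponent b M) D)
    (hBD : Indep (processSigma B) (processSigma D) P) (t : ℝ≥0) :
    Tendsto (fun L => ∑ l ∈ Finset.range L, Real.exp (-(t : ℝ) * laplaceExponent b M (eigen l))
      * inner ℝ Z (hT.component l x)) atTop (𝓝 (∫ ω, hT.cov Z (subordinate B D t ω) ∂P)) := by
  rw [integral_subordinate hB.measurable hB.cts hD.measurable hBD]
  obtain ⟨C, hC⟩ := hT.abs_sum_exp_inner_component_le x
  have hle : ∀ ω l, |Real.exp (-(D t ω : ℝ) * eigen l)| ≤ 1 := by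
    intro ω l
    rw [abs_of_nonneg (Real.exp_nonneg _)]
    refine Real.exp_le_one_iff.2 ?_
    have := mul_nonneg (D t ω).coe_nonneg (eigen_nonneg l)
    linarith
  have hmeas : ∀ l, Measurable fun ω => Real.exp (-(D t ω : ℝ) * eigen l) := fun l =>
    (((measurable_coe_nnreal_real.comp (hD.measurable t)).neg).mul_const _).exp
  have h := tendsto_integral_of_dominated_convergence (μ := P) (fun _ => ‖Z‖ * C)
    (F := fun L ω => ∑ l ∈ Finset.range L, Real.exp (-(D t ω : ℝ) * eigen l)
      * inner ℝ Z (hT.component l x)) (f := fun ω => ∫ ω', hT.cov Z (B (D t ω) ω') ∂P)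
    (fun L => (Finset.measurable_fun_sum _ fun l _ =>
      (hmeas l).mul_const _).aestronglyMeasurable)
    (integrable_const _)
    (fun L => Eventually.of_forall fun ω => hC Z L _ (hle ω))
    (Eventually.of_forall fun ω => hT.tendsto_integral_cov_brownian Z hB (D t ω))
  refine h.congr fun L => ?_
  rw [integral_finsetSum _ fun l _ => ?_]
  · simp only [integral_mul_const, hD.integral_exp_eigen]
  · exact (Integrable.of_bound (hmeas l).aestronglyMeasurable 1
      (Eventually.of_forall fun ω => hle ω l)).mul_const _

/-- Orthogonality and bounded multipliers make the series converge in norm. Its limit and the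
average both lie in the span and have equal covariances with every `T(w)`, hence coincide. -/
theorem tendsto_sum_smear_subordinate (hT : IsIsotropicGaussianField P T)
    {x : S2} {B : ℝ≥0 → Ω → S2} (hB : IsSphericalBrownian P x B) {b : ℝ≥0} {M : Measure ℝ}
    {D : ℝ≥0 → Ω → ℝ≥0} (hD : IsSubordinator P (laplaceExponent b M) D)
    (hBD : Indep (processSigma B) (processSigma D) P) (t : ℝ≥0) :
    Tendsto (fun L => ∑ l ∈ Finset.range L,
      Real.exp (-(t : ℝ) * laplaceExponent b M (eigen l)) • hT.component l x) atTop
      (𝓝 (hT.smear (P.map (subordinate B D t)) 1)) := by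
  have hV : Measurable (subordinate B D t) :=
    measurable_subordinate hB.cts hB.measurable hD.measurable t
  have hcauchy := cauchySeq_sum_smul_of_orthogonal
    (fun l m hlm => hT.inner_component_of_ne hlm x x) (hD.abs_exp_laplaceExponent_le t)
    (hT.tendsto_sum_component x).cauchySeq
  obtain ⟨S, hS⟩ := cauchySeq_tendsto_of_complete hcauchy
  have hSmem : S ∈ hT.space :=
    (Submodule.isClosed_topologicalClosure _).mem_of_tendsto hS (Eventually.of_forall fun L =>
      hT.space.sum_mem fun l _ => hT.space.smul_mem _ (hT.component_mem_space l x))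
  have h0 : hT.smear (P.map (subordinate B D t)) 1 - S = 0 := by
    refine hT.eq_zero_of_mem_of_inner_toL2
      (hT.space.sub_mem (hT.smear_mem_space _ _) hSmem) fun w => ?_
    rw [real_inner_comm, inner_sub_right, sub_eq_zero, inner_smear]
    have h1 := hT.tendsto_integral_cov_subordinate (hT.toL2 w) hB hD hBD t
    have h2 := (continuous_const.inner continuous_id : Continuous fun W : Lp ℝ 2 P =>
      inner ℝ (hT.toL2 w) W).continuousAt.tendsto.comp hS
    have h3 : ∫ z, (1 : C(S2, ℝ)) z * inner ℝ (hT.toL2 w) (hT.toL2 z) ∂(P.map (subordinate B D t))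
        = ∫ ω, hT.cov (hT.toL2 w) (subordinate B D t ω) ∂P := by
      rw [← integral_map hV.aemeasurable
        (hT.cov (hT.toL2 w)).continuous.aestronglyMeasurable]
      simp [cov_apply]
    rw [h3]
    refine tendsto_nhds_unique h1 (h2.congr fun L => ?_)
    simp [inner_sum, inner_smul_right]
  rwa [sub_eq_zero.1 h0]

end IsIsotropicGaussianField

/-! ### The conditional expectation given the field. -/

theorem IsIsotropicGaussianField.integrable_subordinateField {Ω : Type*} {𝓖 : MeasurableSpace Ω}
    [mΩ : MeasurableSpace Ω] {P : Measure Ω} [IsProbabilityMeasure P] {T : S2 → Ω → ℝ}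
    (hT : IsIsotropicGaussianField P T)
    (h𝓖 : 𝓖 ≤ mΩ)
    (hT𝓖 : Measurable[MeasurableSpace.prod Subtype.instMeasurableSpace 𝓖]
      (fun p : S2 × Ω => T p.1 p.2))
    {V : Ω → S2} (hV : Measurable V) (hind : Indep (MeasurableSpace.comap V inferInstance) 𝓖 P) :
    Integrable (fun ω => T (V ω) ω) P := by
  have hindep : @IndepFun Ω S2 Ω mΩ inferInstance 𝓖 V id P := by
    refine (@IndepFun_iff_Indep Ω S2 Ω mΩ _ 𝓖 V id P).2 ?_
    rwa [MeasurableSpace.comap_id]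
  refine (@ProbabilityTheory.IndepFun.integrable_comp_iff Ω S2 Ω mΩ _ 𝓖 P _ V id
    hindep hV (measurable_id'' h𝓖) _ hT𝓖).2 ?_
  have : IsProbabilityMeasure (P.map V) := Measure.isProbabilityMeasure_map hV.aemeasurable
  exact (hT.memLp_uncurry (P.map V)).integrable (by norm_num)

/-- For `A ∈ 𝔉_T`, independence of `V` and `𝓖` turns `E[T(V) 1_A]` into an integral over the product
of the law of `V` with `P`; Fubini then gives the integral over `A` of the averaged field. -/
theorem IsIsotropicGaussianField.condExp_subordinateField {Ω : Type*} {𝓖 : MeasurableSpace Ω}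
    [mΩ : MeasurableSpace Ω] {P : Measure Ω} [IsProbabilityMeasure P] {T : S2 → Ω → ℝ}
    (hT : IsIsotropicGaussianField P T)
    (h𝓖 : 𝓖 ≤ mΩ)
    (hT𝓖 : Measurable[MeasurableSpace.prod Subtype.instMeasurableSpace 𝓖]
      (fun p : S2 × Ω => T p.1 p.2))
    {V : Ω → S2} (hV : Measurable V) (hind : Indep (MeasurableSpace.comap V inferInstance) 𝓖 P) :
    P[fun ω => T (V ω) ω | fieldSigma T] =ᵐ[P] hT.smear (P.map V) 1 := by
  have hindep : @IndepFun Ω S2 Ω mΩ inferInstance 𝓖 V id P := by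
    refine (@IndepFun_iff_Indep Ω S2 Ω mΩ _ 𝓖 V id P).2 ?_
    rwa [MeasurableSpace.comap_id]
  have hT𝓖' : fieldSigma T ≤ 𝓖 := iSup_le fun x =>
    (hT𝓖.comp (@measurable_prodMk_left S2 Ω _ 𝓖 x)).comap_le
  have : IsProbabilityMeasure (P.map V) := Measure.isProbabilityMeasure_map hV.aemeasurable
  have hint : Integrable (fun p : S2 × Ω => T p.1 p.2) ((P.map V).prod P) :=
    (hT.memLp_uncurry (P.map V)).integrable (by norm_num)
  symm
  refine ae_eq_condExp_of_forall_setIntegral_eq (hT𝓖'.trans h𝓖)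
    (hT.integrable_subordinateField h𝓖 hT𝓖 hV hind)
    (fun A _ _ => ((Lp.memLp _).integrable (by norm_num)).integrableOn) ?_
    (hT.aestronglyMeasurable_of_mem_space (hT.smear_mem_space _ _))
  intro A hA _
  have hAm : MeasurableSet A := h𝓖 _ (hT𝓖' _ hA)
  have hA' : @MeasurableSet (S2 × Ω) (@Prod.instMeasurableSpace _ _ _ 𝓖) (Prod.snd ⁻¹' A) :=
    (@measurable_snd S2 Ω _ 𝓖) (hT𝓖' _ hA)
  have h := @ProbabilityTheory.IndepFun.integral_comp Ω S2 Ω mΩ _ 𝓖 P _ V id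
    hindep hV (measurable_id'' h𝓖) ((Prod.snd ⁻¹' A).indicator fun p : S2 × Ω => T p.1 p.2)
    (hT𝓖.indicator hA')
  have hL : ∀ ω, (Prod.snd ⁻¹' A).indicator (fun p : S2 × Ω => T p.1 p.2) (V ω, id ω)
      = A.indicator (fun ω => T (V ω) ω) ω := fun ω => by
    by_cases hω : ω ∈ A <;> simp [hω]
  simp only [hL] at h
  rw [integral_indicator hAm] at h
  rw [h, setIntegral_congr_ae hAm ((hT.coeFn_smear (P.map V) 1).mono fun ω hω _ => hω)]
  have hint' : Integrable (fun p : S2 × Ω => (Prod.snd ⁻¹' A).indicator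
      (fun p : S2 × Ω => T p.1 p.2) (p.1, id p.2)) ((P.map V).prod P) :=
    hint.indicator (measurable_snd hAm)
  rw [integral_prod_symm _ hint', ← integral_indicator hAm]
  refine integral_congr_ae (Eventually.of_forall fun ω => ?_)
  by_cases hω : ω ∈ A <;> simp [hω]

end SphereField

/-! ### Moments as unconditionally convergent multiple series. -/

/-- For nonnegative terms, one exhausting sequence of finite sets bounds all finite sums. -/
theorem hasSum_of_nonneg_of_tendsto {ι : Type*} {f : ι → ℝ} (hf : ∀ i, 0 ≤ f i)
    {s : ℕ → Finset ι} (hs : Tendsto s atTop atTop) {a : ℝ}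
    (h : Tendsto (fun L => ∑ i ∈ s L, f i) atTop (𝓝 a)) : HasSum f a := by
  have hsum : Summable f := summable_of_sum_le (c := a) hf fun t => by
    refine ge_of_tendsto h ?_
    filter_upwards [hs.eventually_ge_atTop t] with L hL
    exact Finset.sum_le_sum_of_subset_of_nonneg hL fun i _ _ => hf i
  have h2 : Tendsto (fun L => ∑ i ∈ s L, f i) atTop (𝓝 (∑' i, f i)) := hsum.hasSum.comp hs
  rw [tendsto_nhds_unique h h2]
  exact hsum.hasSum

namespace SphereField

open GaussianHilbert

section Moments

variable {Ω : Type*} [mΩ : MeasurableSpace Ω] {P : Measure Ω} [IsProbabilityMeasure P]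

/-- The moments of an orthogonal series of Gaussian variables expand into an unconditionally
convergent multiple series. -/
theorem hasSum_integral_prod_of_orthogonal {H : Submodule ℝ (Lp ℝ 2 P)}
    (hH : ∀ Z ∈ H, IsCenteredGaussian Z) {u : ℕ → Lp ℝ 2 P} (hu : ∀ l, u l ∈ H)
    (horth : ∀ l m, l ≠ m → inner ℝ (u l) (u m) = 0) {S : Lp ℝ 2 P} (hS : S ∈ H)
    (hlim : Tendsto (fun L => ∑ l ∈ Finset.range L, u l) atTop (𝓝 S)) (n : ℕ) :
    HasSum (fun l : Fin n → ℕ => ∫ ω, ∏ j, u (l j) ω ∂P) (∫ ω, S ω ^ n ∂P) := by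
  refine hasSum_of_nonneg_of_tendsto (fun l => integral_prod_nonneg hH hu horth l)
    (s := fun L => Fintype.piFinset fun _ => Finset.range L) ?_ ?_
  · refine tendsto_atTop_finset_of_monotone (fun L L' hL => ?_) fun l => ?_
    · exact Fintype.piFinset_subset _ _ fun _ => Finset.range_mono hL
    · refine ⟨Finset.univ.sup l + 1, Fintype.mem_piFinset.2 fun j => Finset.mem_range.2 ?_⟩
      exact Nat.lt_succ_of_le (Finset.le_sup (f := l) (Finset.mem_univ j))
  · rw [(hH S hS).integral_pow]
    -- The sum over the cube `l_j < L` is the `n`-th moment of a Gaussian partial sum, hence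
    -- determined by its norm; convergence in `L^n` is not needed.
    have h1 : ∀ L, ∑ l ∈ Fintype.piFinset fun _ : Fin n => Finset.range L, ∫ ω, ∏ j, u (l j) ω ∂P
        = ‖∑ l ∈ Finset.range L, u l‖ ^ n * ∫ x, x ^ n ∂(gaussianReal 0 1) := by
      intro L
      rw [← (hH _ (H.sum_mem fun l _ => hu l)).integral_pow,
        ← integral_finsetSum _ fun l _ => integrable_prod _ fun j => hH _ (hu (l j))]
      refine integral_congr_ae ?_
      filter_upwards [Lp.coeFn_finsetSum (s := Finset.range L) (f := u)] with ω hω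
      rw [hω, Finset.sum_apply, ← Finset.prod_univ_sum (fun _ => Finset.range L)
        (fun _ l => u l ω), Finset.prod_const, Finset.card_univ, Fintype.card_fin]
    simp only [h1]
    exact ((hlim.norm).pow n).mul_const _

end Moments

section Field

variable {Ω : Type*} [mΩ : MeasurableSpace Ω] {P : Measure Ω} [IsProbabilityMeasure P]
  {T : S2 → Ω → ℝ}

theorem IsIsotropicGaussianField.ae_prod_harmonicCoeff (hT : IsIsotropicGaussianField P T) {n : ℕ}
    (l : Fin n → ℕ) :
    ∀ᵐ ω ∂P, ((∏ j, hT.component (l j) northPole ω : ℝ) : ℂ)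
      = (Real.sqrt ((∏ j, (2 * (l j : ℝ) + 1)) / (4 * Real.pi) ^ n) : ℂ)
        * ∏ j, harmonicCoeff T (l j) 0 ω := by
  have h1 : ∀ᵐ ω ∂P, ∀ l, (hT.component l northPole ω : ℂ)
      = (Real.sqrt ((2 * (l : ℝ) + 1) / (4 * Real.pi)) : ℂ) * harmonicCoeff T l 0 ω :=
    ae_all_iff.2 hT.component_northPole
  have h2 : Real.sqrt ((∏ j, (2 * (l j : ℝ) + 1)) / (4 * Real.pi) ^ n)
      = ∏ j, Real.sqrt ((2 * (l j : ℝ) + 1) / (4 * Real.pi)) := by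
    rw [← Real.sqrt_prod _ fun j _ => by positivity, Finset.prod_div_distrib, Finset.prod_const,
      Finset.card_univ, Fintype.card_fin]
  filter_upwards [h1] with ω h1
  rw [h2, Complex.ofReal_prod, Complex.ofReal_prod, ← Finset.prod_mul_distrib]
  exact Finset.prod_congr rfl fun j _ => h1 _

theorem IsIsotropicGaussianField.integrable_prod_harmonicCoeff
    (hT : IsIsotropicGaussianField P T) {n : ℕ} (l : Fin n → ℕ) :
    Integrable (fun ω => ∏ j, harmonicCoeff T (l j) 0 ω) P := by
  have h0 : (Real.sqrt ((∏ j, (2 * (l j : ℝ) + 1)) / (4 * Real.pi) ^ n) : ℂ) ≠ 0 := by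
    rw [Complex.ofReal_ne_zero, Real.sqrt_ne_zero']
    have : 0 < ∏ j, (2 * (l j : ℝ) + 1) := Finset.prod_pos fun j _ => by positivity
    positivity
  have h := ((integrable_prod (fun j => hT.component (l j) northPole) fun j =>
    hT.isCenteredGaussian_of_mem _ (hT.component_mem_space _ _)).ofReal (𝕜 := ℂ)).const_mul
      (Real.sqrt ((∏ j, (2 * (l j : ℝ) + 1)) / (4 * Real.pi) ^ n) : ℂ)⁻¹
  refine h.congr ?_
  filter_upwards [hT.ae_prod_harmonicCoeff l] with ω hω
  have hω' := hω
  simp only [RCLike.ofReal_eq_complex_ofReal] at hω' ⊢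
  rw [hω', inv_mul_cancel_left₀ h0]

theorem IsIsotropicGaussianField.hasSum_moment (hT : IsIsotropicGaussianField P T) (c : ℕ → ℝ)
    {S : Lp ℝ 2 P} (hS : S ∈ hT.space)
    (hlim : Tendsto (fun L => ∑ l ∈ Finset.range L, c l • hT.component l northPole) atTop (𝓝 S))
    (n : ℕ) :
    HasSum (fun l : Fin n → ℕ => ((∏ j, c (l j) : ℝ) : ℂ)
        * (Real.sqrt ((∏ j, (2 * (l j : ℝ) + 1)) / (4 * Real.pi) ^ n) : ℂ)
        * ∫ ω, ∏ j, harmonicCoeff T (l j) 0 ω ∂P) ((∫ ω, S ω ^ n ∂P : ℝ) : ℂ) := by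
  have h := hasSum_integral_prod_of_orthogonal hT.isCenteredGaussian_of_mem
    (fun l => hT.space.smul_mem (c l) (hT.component_mem_space l northPole))
    (fun l m hlm => by
      rw [inner_smul_left, inner_smul_right, hT.inner_component_of_ne hlm, mul_zero, mul_zero])
    hS hlim n
  have e : ∀ l : Fin n → ℕ, ((∏ j, c (l j) : ℝ) : ℂ)
        * (Real.sqrt ((∏ j, (2 * (l j : ℝ) + 1)) / (4 * Real.pi) ^ n) : ℂ)
        * ∫ ω, ∏ j, harmonicCoeff T (l j) 0 ω ∂P
      = ((∫ ω, ∏ j, (c (l j) • hT.component (l j) northPole : Lp ℝ 2 P) ω ∂P : ℝ) : ℂ) := by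
    intro l
    rw [mul_assoc, ← integral_const_mul, ← integral_const_mul, ← integral_complex_ofReal]
    refine integral_congr_ae ?_
    have h1 : ∀ᵐ ω ∂P, ∀ k, (c k • hT.component k northPole : Lp ℝ 2 P) ω
        = c k * hT.component k northPole ω :=
      ae_all_iff.2 fun k => (Lp.coeFn_smul (c k) (hT.component k northPole)).mono fun ω hω => by
        rw [hω]; rfl
    filter_upwards [h1, hT.ae_prod_harmonicCoeff l] with ω h1 h2
    simp only [h1]
    rw [Finset.prod_mul_distrib, Complex.ofReal_mul, h2]
  simp only [e]
  exact Complex.hasSum_ofReal.2 h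

end Field

end SphereField

/-! ### The moment formula. -/

theorem mainTheorem6 {Ω : Type*} (𝓖 : MeasurableSpace Ω) [mΩ : MeasurableSpace Ω]
    (P : Measure Ω) [IsProbabilityMeasure P]
    (T : S2 → Ω → ℝ) (hT : IsIsotropicGaussianField P T)
    (b : ℝ≥0) (M : Measure ℝ) (hM : IsSubordinatorLevyMeasure M)
    (B : S2 → ℝ≥0 → Ω → S2) (hB : ∀ x, IsSphericalBrownian P x (B x))
    (D : S2 → ℝ≥0 → Ω → ℝ≥0) (hD : ∀ x, IsSubordinator P (laplaceExponent b M) (D x))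
    (hBD : ∀ x, Indep (processSigma (B x)) (processSigma (D x)) P)
    (h𝓖 : 𝓖 ≤ mΩ)
    (hT𝓖 : Measurable[MeasurableSpace.prod Subtype.instMeasurableSpace 𝓖] (fun p : S2 × Ω => T p.1 p.2))
    (hind : ∀ x, Indep 𝓖 (processSigma (B x) ⊔ processSigma (D x)) P)
    (t : ℝ≥0) (n : ℕ) (x : S2) (g : SO3) :
    (∀ y, Integrable (subordinateField T B D t y) P) ∧
    (∀ y, Integrable (fun ω => meanSubordinateField P T B D t y ω ^ n) P) ∧
    (∀ l : Fin n → ℕ, Integrable (fun ω => ∏ j, harmonicCoeff T (l j) 0 ω) P) ∧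
    ∫ ω, meanSubordinateField P T B D t (rotate g x) ω ^ n ∂P
      = ∫ ω, meanSubordinateField P T B D t x ω ^ n ∂P ∧
    HasSum
      (fun l : Fin n → ℕ =>
        ((∏ j, Real.exp (-(t : ℝ) * laplaceExponent b M (eigen (l j))) : ℝ) : ℂ)
          * (Real.sqrt ((∏ j, (2 * (l j : ℝ) + 1)) / (4 * Real.pi) ^ n) : ℂ)
          * ∫ ω, ∏ j, harmonicCoeff T (l j) 0 ω ∂P)
      ((∫ ω, meanSubordinateField P T B D t (rotate g x) ω ^ n ∂P : ℝ) : ℂ) := by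
  have hV : ∀ y, Measurable (subordinate (B y) (D y) t) := fun y =>
    measurable_subordinate (hB y).cts (hB y).measurable (hD y).measurable t
  have hVind : ∀ y, Indep (MeasurableSpace.comap (subordinate (B y) (D y) t) inferInstance) 𝓖 P := by
    intro y
    refine indep_of_indep_of_le_left (hind y).symm ?_
    have hVm : Measurable[processSigma (B y) ⊔ processSigma (D y)] (subordinate (B y) (D y) t) :=
      @measurable_subordinate Ω (processSigma (B y) ⊔ processSigma (D y)) (B y) (D y) (hB y).cts
        (fun t => (measurable_processSigma (B y) t).mono le_sup_left le_rfl)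
        (fun t => (measurable_processSigma (D y) t).mono le_sup_right le_rfl) t
    exact hVm.comap_le
  have hη : ∀ y, meanSubordinateField P T B D t y
      =ᵐ[P] hT.smear (P.map (subordinate (B y) (D y) t)) 1 := fun y =>
    hT.condExp_subordinateField h𝓖 hT𝓖 (hV y) (hVind y)
  have hmem : ∀ y, hT.smear (P.map (subordinate (B y) (D y) t)) 1 ∈ hT.space := fun y =>
    hT.smear_mem_space _ _
  have hG : ∀ y, GaussianHilbert.IsCenteredGaussian
      (hT.smear (P.map (subordinate (B y) (D y) t)) 1) := fun y =>
    hT.isCenteredGaussian_of_mem _ (hmem y)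
  have hlim := fun y => hT.tendsto_sum_smear_subordinate (hB y) (hD y) (hBD y) t
  have hnorm : ∀ y, ‖hT.smear (P.map (subordinate (B y) (D y) t)) 1‖
      = ‖hT.smear (P.map (subordinate (B northPole) (D northPole) t)) 1‖ := fun y =>
    tendsto_nhds_unique (hlim y).norm
      -- The motions started at different points need not be related: their norms agree because
      -- those of the partial sums do.
      ((hlim northPole).norm.congr fun L => (hT.norm_sum_smul_component _ _ y).symm)
  have hpow : ∀ y, (fun ω => meanSubordinateField P T B D t y ω ^ n)
      =ᵐ[P] fun ω => hT.smear (P.map (subordinate (B y) (D y) t)) 1 ω ^ n := fun y =>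
    (hη y).mono fun ω hω => by simp only [hω]
  have hint : ∀ y, ∫ ω, meanSubordinateField P T B D t y ω ^ n ∂P
      = ∫ ω, hT.smear (P.map (subordinate (B northPole) (D northPole) t)) 1 ω ^ n ∂P := by
    intro y
    rw [integral_congr_ae (hpow y), (hG y).integral_pow, (hG northPole).integral_pow, hnorm y]
  refine ⟨fun y => hT.integrable_subordinateField h𝓖 hT𝓖 (hV y) (hVind y), fun y => ?_,
    fun l => hT.integrable_prod_harmonicCoeff l, by rw [hint, hint], ?_⟩
  · rw [integrable_congr (hpow y)]
    have h := GaussianHilbert.integrable_prod (n := n)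
      (fun _ => hT.smear (P.map (subordinate (B y) (D y) t)) 1) fun _ => hG y
    simpa using h
  -- The moment is evaluated at the pole, where the components are multiples of the `a_{l0}`.
  · rw [hint]
    exact hT.hasSum_moment (fun l => Real.exp (-(t : ℝ) * laplaceExponent b M (eigen l)))
      (hmem northPole) (hlim northPole) n
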